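/- Let $r\ge 1$ be an integer. Let $Cl_r$ be the real Clifford algebra generated by the standard basis $e_1,\dots,e_r$ of $\mathbb R^r$ subject to $e_je_k+e_ke_j=-2\delta_{jk}$, and let $Cl_r^0$ be its even subalgebra. Let $Spin(r)\subset Cl_r^0$ be the group of even products of unit vectors of $\mathbb R^r$, with Lie algebra $\mathfrak{spin}(r)=\mathrm{span}\{e_ie_j : i<j\}$. For $r\not\equiv 0 \pmod 4$ let $\tilde\Delta_r$ be the irreducible real representation of $Cl_r^0$, and for $r\equiv 0\pmod 4$ let $\tilde\Delta_r^{+},\tilde\Delta_r^-$ be the two non-isomorphic irreducible real representations of $Cl_r^0$. Each is equipped with an inner product for which every $e_ie_j$ ($i<j$) acts by a skew-symmetric endomorphism, and $d_r$ denotes its dimension. Thus $\mathfrak{spin}(r)$ acts through $\mathfrak{so}(d_r)=\mathfrak{so}(\tilde\Delta_r)$, respectively through $\mathfrak{so}(d_r)\oplus\mathfrak{so}(d_r)=\mathfrak{so}(\tilde\Delta_r^+)\oplus\mathfrak{so}(\tilde\Delta_r^-)$ (diagonally). For a Euclidean space $V$ let $\mathrm{Sym}^2_0V$ be the orthogonal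 complement of the identity in the space of symmetric endomorphisms of $V$ (the trace-free ones), and identify $\Lambda^2V\cong\mathfrak{so}(V)$ by $a\wedge b\mapsto(x\mapsto\langle a,x\rangle b-\langle b,x\rangle a)$. (1) The centralizer of (the image of) $\mathfrak{spin}(r)$ is, up to isomorphism of real Lie algebras: - in $\mathfrak{so}(d_r)$: $\{0\}$ if $r\equiv\pm1$; $\mathfrak u(1)$ if $r\equiv\pm2$; $\mathfrak{sp}(1)$ if $r\equiv\pm3\pmod 8$; - in $\mathfrak{so}(d_r)\oplus\mathfrak{so}(d_r)$: $\{0\}$ if $r\equiv0$; $\mathfrak{sp}(1)\oplus\mathfrak{sp}(1)$ if $r\equiv4\pmod 8$. (2) The largest trivial $Spin(r)$-subrepresentation (the space of $Spin(r)$-invariants) - of $\Lambda^2\tilde\Delta_r$ (respectively of each of $\Lambda^2\tilde\Delta_r^{+}$, $\Lambda^2\tilde\Delta_r^{-}$) is $\{0\}$ if $r\equiv0,\pm1\pmod 8$; if $r\equiv\pm2\pmod 8$ it is a Lie subalgebra of $\mathfrak{so}(d_r)\cong\Lambda^2$ isomorphic to $\mathfrak u(1)$; if $r\equiv\pm3$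 or $4\pmod 8$ it is a Lie subalgebra of $\mathfrak{so}(d_r)\cong\Lambda^2$ isomorphic to $\mathfrak{sp}(1)$; - of $\mathrm{Sym}_0^2\tilde\Delta_r$ (respectively of each of $\mathrm{Sym}_0^2\tilde\Delta_r^{+}$, $\mathrm{Sym}_0^2\tilde\Delta_r^{-}$) is $\{0\}$ for every $r$; - of $\tilde\Delta_r^+\otimes\tilde\Delta_r^-$ is $\{0\}$ for every $r\equiv0\pmod 4$. -/

import Mathlib

open scoped TensorProduct Quaternion

attribute [local instance 100] LieRing.ofAssociativeRing

noncomputable section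

namespace SpinCentralizer

/-! ### The Clifford algebra of Euclidean space, and `spin(r)` -/

/-- The negative definite form `-(x₁² + ⋯ + xᵣ²)` on `ℝʳ`: the generators of its Clifford algebra
satisfy `eⱼ eₖ + eₖ eⱼ = -2 δⱼₖ`. -/
def Q (r : ℕ) : QuadraticForm ℝ (Fin r → ℝ) :=
  QuadraticMap.weightedSumSquares ℝ (fun _ : Fin r => (-1 : ℝ))

/-- The Clifford algebra `Cl_r`. -/
abbrev Cl (r : ℕ) : Type := CliffordAlgebra (Q r)

/-- The even Clifford algebra `Cl_r⁰`. -/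
abbrev ClEven (r : ℕ) : Type := CliffordAlgebra.even (Q r)

/-- The generator `eᵢ` of `Cl_r`. -/
def e (r : ℕ) (i : Fin r) : Cl r := CliffordAlgebra.ι (Q r) (Pi.single i 1)

/-- The bivector `eᵢ eⱼ`, as an element of `Cl_r⁰`. -/
def bivector (r : ℕ) (i j : Fin r) : ClEven r :=
  (CliffordAlgebra.even.ι (Q r)).bilin (Pi.single i 1) (Pi.single j 1)

theorem coe_bivector (r : ℕ) (i j : Fin r) : (bivector r i j : Cl r) = e r i * e r j := rfl

theorem e_mul_e_add (r : ℕ) (i j : Fin r) :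
    e r i * e r j + e r j * e r i = algebraMap ℝ (Cl r) (if i = j then -2 else 0) := by
  unfold e
  rw [CliffordAlgebra.ι_mul_ι_add_swap]
  congr 1
  simp only [QuadraticMap.polar, Q, QuadraticMap.weightedSumSquares_apply, Pi.add_apply]
  rw [← Finset.sum_sub_distrib, ← Finset.sum_sub_distrib]
  split_ifs with h
  · subst h
    rw [Finset.sum_eq_single i]
    · simp; norm_num
    · intro b _ hb; simp [Pi.single_eq_of_ne hb]
    · simp
  · apply Finset.sum_eq_zero
    intro b _
    by_cases hb : b = i
    · subst hb; simp [Pi.single_eq_of_ne h]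
    · simp [Pi.single_eq_of_ne hb]

/-- The underlying space `span {eᵢ eⱼ | i < j}` of `spin(r)`. -/
def spinSpan (r : ℕ) : Submodule ℝ (ClEven r) :=
  Submodule.span ℝ {x | ∃ i j : Fin r, i < j ∧ x = bivector r i j}

theorem bivector_add (r : ℕ) (i j : Fin r) :
    bivector r i j + bivector r j i = algebraMap ℝ (ClEven r) (if i = j then -2 else 0) :=
  Subtype.ext (e_mul_e_add r i j)

theorem bivector_add_one_mem (r : ℕ) (i j : Fin r) :
    bivector r i j + algebraMap ℝ (ClEven r) (if i = j then 1 else 0) ∈ spinSpan r := by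
  have h := bivector_add r i j
  rcases lt_trichotomy i j with hij | hij | hij
  · rw [if_neg hij.ne, map_zero, add_zero]
    exact Submodule.subset_span ⟨i, j, hij, rfl⟩
  · subst hij
    have h2 : (2 : ℝ) • (bivector r i i + algebraMap ℝ (ClEven r) 1) = 0 := by
      rw [two_smul]
      calc _ = (bivector r i i + bivector r i i) + algebraMap ℝ (ClEven r) 2 := by
            rw [show (2 : ℝ) = 1 + 1 by norm_num, map_add]; abel
        _ = 0 := by rw [h, ← map_add]; simp
    have h3 := (smul_eq_zero.1 h2).resolve_left two_ne_zero
    simp only [if_true]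
    rw [h3]
    exact zero_mem _
  · have h1 : bivector r j i ∈ spinSpan r := Submodule.subset_span ⟨j, i, hij, rfl⟩
    rw [if_neg hij.ne', map_zero] at h
    rw [if_neg hij.ne', map_zero, add_zero, eq_neg_of_add_eq_zero_left h]
    exact neg_mem h1

theorem bivector_lie_mem (r : ℕ) (i j k l : Fin r) :
    ⁅bivector r i j, bivector r k l⁆ ∈ spinSpan r := by
  let β : Fin r → Fin r → ℝ := fun a b => if a = b then -2 else 0
  let T : Fin r → Fin r → ClEven r :=
    fun a b => bivector r a b + algebraMap ℝ (ClEven r) (if a = b then 1 else 0)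
  have hT : ∀ a b, T a b ∈ spinSpan r := bivector_add_one_mem r
  have key : ⁅bivector r i j, bivector r k l⁆ =
      β j k • T i l - β i k • T j l + β j l • T k i - β i l • T k j := by
    apply Subtype.ext
    have hab : ∀ a b, e r a * e r b = algebraMap ℝ (Cl r) (β a b) - e r b * e r a := fun a b =>
      eq_sub_of_add_eq (e_mul_e_add r a b)
    have hc : ∀ a b c, e r a * e r b * e r c =
        β b c • e r a - β a c • e r b + e r c * e r a * e r b := by
      intro a b c
      rw [mul_assoc, hab b c, mul_sub, ← mul_assoc, hab a c, sub_mul, Algebra.smul_def,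
        Algebra.smul_def, Algebra.commutes (β b c)]
      abel
    have hT' : ∀ a b, ((T a b : ClEven r) : Cl r) =
        e r a * e r b + algebraMap ℝ (Cl r) (if a = b then 1 else 0) := fun _ _ => rfl
    have hl : ((⁅bivector r i j, bivector r k l⁆ : ClEven r) : Cl r) =
        e r i * e r j * (e r k * e r l) - e r k * e r l * (e r i * e r j) := rfl
    have h1 : e r i * e r j * (e r k * e r l) - e r k * e r l * (e r i * e r j) =
        β j k • (e r i * e r l) - β i k • (e r j * e r l) + β j l • (e r k * e r i)
          - β i l • (e r k * e r j) := by
      have h2 : e r i * e r j * (e r k * e r l) = (e r i * e r j * e r k) * e r l := by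
        simp only [mul_assoc]
      have h3 : e r k * e r i * e r j * e r l = e r k * (e r i * e r j * e r l) := by
        simp only [mul_assoc]
      rw [h2, hc i j k, add_mul, sub_mul, h3, hc i j l]
      simp only [mul_add, mul_sub, smul_mul_assoc, mul_smul_comm, mul_assoc]
      abel
    have hs : β j k * (if i = l then 1 else 0) - β i k * (if j = l then 1 else 0)
        + β j l * (if k = i then 1 else 0) - β i l * (if k = j then 1 else 0) = (0 : ℝ) := by
      simp only [β, eq_comm (a := k) (b := i), eq_comm (a := k) (b := j)]
      split_ifs <;> norm_num
    have hs' := congrArg (algebraMap ℝ (Cl r)) hs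
    rw [hl, h1]
    push_cast
    simp only [hT', smul_add]
    simp only [map_add, map_sub, map_mul, map_zero] at hs'
    simp only [← Algebra.smul_def] at hs'
    rw [← sub_eq_zero]
    rw [← neg_eq_zero] at hs'
    rw [← hs']
    abel
  rw [key]
  exact sub_mem (add_mem (sub_mem (Submodule.smul_mem _ _ (hT _ _))
    (Submodule.smul_mem _ _ (hT _ _))) (Submodule.smul_mem _ _ (hT _ _)))
    (Submodule.smul_mem _ _ (hT _ _))

/-- The Lie algebra `spin(r) = span {eᵢ eⱼ | i < j}`, inside `Cl_r⁰` with the commutator bracket. -/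
def spin (r : ℕ) : LieSubalgebra ℝ (ClEven r) where
  toSubmodule := spinSpan r
  lie_mem' := by
    intro x y hx hy
    change x ∈ spinSpan r at hx
    change y ∈ spinSpan r at hy
    change ⁅x, y⁆ ∈ spinSpan r
    induction hx using Submodule.span_induction with
    | mem x hx =>
      obtain ⟨i, j, -, rfl⟩ := hx
      induction hy using Submodule.span_induction with
      | mem y hy =>
        obtain ⟨k, l, -, rfl⟩ := hy
        exact bivector_lie_mem r i j k l
      | zero => rw [lie_zero]; exact zero_mem _
      | add y z _ _ hy hz => rw [lie_add]; exact add_mem hy hz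
      | smul c y _ hy => rw [lie_smul]; exact Submodule.smul_mem _ _ hy
    | zero => rw [zero_lie]; exact zero_mem _
    | add x z _ _ hx hz => rw [add_lie]; exact add_mem hx hz
    | smul c x _ hx => rw [smul_lie]; exact Submodule.smul_mem _ _ hx

/-- The group `Spin(r)`: the even products of unit vectors of `ℝʳ` in `Cl_r`. -/
abbrev Spin (r : ℕ) : Type := spinGroup (Q r)

/-! ### Lie algebras -/

/-- The centralizer of a Lie subalgebra `S` of a Lie algebra `L`. -/
def lieCentralizer {L : Type*} [LieRing L] [LieAlgebra ℝ L] (S : LieSubalgebra ℝ L) :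
    LieSubalgebra ℝ L where
  carrier := {x | ∀ y ∈ S, ⁅x, y⁆ = 0}
  add_mem' := by
    intro a b ha hb y hy
    rw [add_lie, ha y hy, hb y hy, add_zero]
  zero_mem' := by
    intro y _
    exact zero_lie y
  smul_mem' := by
    intro c x hx y hy
    rw [smul_lie, hx y hy, smul_zero]
  lie_mem' := by
    intro a b ha hb y hy
    rw [lie_lie, hb y hy, ha y hy]
    simp

/-- The skew-Hermitian `n × n` matrices over `𝕂`. -/
def skewHermitian (𝕂 : Type*) [Ring 𝕂] [StarRing 𝕂] [Algebra ℝ 𝕂] [StarModule ℝ 𝕂] (n : ℕ) :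
    LieSubalgebra ℝ (Matrix (Fin n) (Fin n) 𝕂) where
  carrier := {A | A.conjTranspose = -A}
  add_mem' := by
    intro A B hA hB
    simp only [Set.mem_ofPred_eq] at *
    rw [Matrix.conjTranspose_add, hA, hB, neg_add]
  zero_mem' := by simp
  smul_mem' := by
    intro c A hA
    simp only [Set.mem_ofPred_eq] at *
    rw [Matrix.conjTranspose_smul, hA]
    simp
  lie_mem' := by
    intro A B hA hB
    simp only [Set.mem_ofPred_eq, LieRing.of_associative_ring_bracket] at *
    change A.conjTranspose = -A at hA
    change B.conjTranspose = -B at hB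
    rw [Matrix.conjTranspose_sub, Matrix.conjTranspose_mul, Matrix.conjTranspose_mul, hA, hB]
    simp

instance instStarModuleQuaternion : StarModule ℝ ℍ[ℝ] where
  star_smul c a := by rw [Quaternion.star_smul]; simp

/-- The unitary Lie algebra `u(n)`. -/
abbrev u (n : ℕ) : LieSubalgebra ℝ (Matrix (Fin n) (Fin n) ℂ) := skewHermitian ℂ n

/-- The compact symplectic Lie algebra `sp(n)`: skew-Hermitian quaternionic matrices. -/
abbrev sp (n : ℕ) : LieSubalgebra ℝ (Matrix (Fin n) (Fin n) ℍ[ℝ]) := skewHermitian ℍ[ℝ] n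

section Euclidean

variable (V : Type*) [NormedAddCommGroup V] [InnerProductSpace ℝ V]

/-- The Lie algebra `so(V)` of skew-adjoint endomorphisms of a Euclidean space `V`. -/
def so : LieSubalgebra ℝ (Module.End ℝ V) := skewAdjointLieSubalgebra (innerₗ V)

variable {V} in
theorem mem_so {A : Module.End ℝ V} :
    A ∈ so V ↔ ∀ x y : V, inner ℝ (A x) y = -inner ℝ x (A y) := by
  change A ∈ (innerₗ V).skewAdjointSubmodule ↔ _
  rw [LinearMap.mem_skewAdjointSubmodule]
  simp [LinearMap.IsSkewAdjoint, LinearMap.IsAdjointPair]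

/-- The space `Sym₀² V`: the symmetric endomorphisms `A` of `V` that are orthogonal to the identity,
that is `⟨A, Id⟩ = tr A = 0`. -/
def symZero : Submodule ℝ (Module.End ℝ V) where
  carrier := {A | A.IsSymmetric ∧ LinearMap.trace ℝ V A = 0}
  add_mem' := by
    intro A B hA hB
    exact ⟨hA.1.add hB.1, by rw [map_add, hA.2, hB.2, add_zero]⟩
  zero_mem' := ⟨LinearMap.IsSymmetric.zero, map_zero _⟩
  smul_mem' := by
    intro c A hA
    refine ⟨fun x y => ?_, by rw [map_smul, hA.2, smul_zero]⟩
    rw [LinearMap.smul_apply, LinearMap.smul_apply, real_inner_smul_left, real_inner_smul_right,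
      hA.1 x y]

variable {V}

/-- The skew-adjoint endomorphism `x ↦ ⟨a, x⟩ b - ⟨b, x⟩ a`. -/
def wedgeEnd (a b : V) : so V :=
  ⟨((innerₗ V a).smulRight b - (innerₗ V b).smulRight a : V →ₗ[ℝ] V), by
    rw [mem_so]
    intro x y
    simp only [LinearMap.sub_apply, LinearMap.smulRight_apply, innerₗ_apply_apply, inner_sub_left,
      inner_sub_right, real_inner_smul_left, real_inner_smul_right, real_inner_comm x]
    ring⟩

theorem wedgeEnd_apply (a b x : V) :
    ((wedgeEnd a b : so V) : Module.End ℝ V) x = inner ℝ a x • b - inner ℝ b x • a := rfl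

/-- `wedgeEnd` as an alternating map. -/
def wedgeAlt : V [⋀^Fin 2]→ₗ[ℝ] so V where
  toFun v := wedgeEnd (v 0) (v 1)
  map_update_add' := by
    intro _ m i x y
    apply Subtype.ext
    ext z
    change ((wedgeEnd _ _ : so V) : Module.End ℝ V) z =
      ((wedgeEnd _ _ : so V) : Module.End ℝ V) z + ((wedgeEnd _ _ : so V) : Module.End ℝ V) z
    fin_cases i <;>
    · simp [wedgeEnd_apply, inner_add_left, add_smul]
      abel
  map_update_smul' := by
    intro _ m i c x
    apply Subtype.ext
    ext z
    change ((wedgeEnd _ _ : so V) : Module.End ℝ V) z = c • ((wedgeEnd _ _ : so V) : Module.End ℝ V) z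
    fin_cases i <;>
    simp [wedgeEnd_apply, real_inner_smul_left, smul_sub, smul_smul, mul_comm c]
  map_eq_zero_of_eq' := by
    intro v i j h hij
    have h01 : v 0 = v 1 := by
      fin_cases i <;> fin_cases j <;> simp_all
    apply Subtype.ext
    ext z
    change ((wedgeEnd _ _ : so V) : Module.End ℝ V) z = 0
    rw [wedgeEnd_apply, h01, sub_self]

/-- The linear map `Λ² V → so(V)`, `a ∧ b ↦ (x ↦ ⟨a, x⟩ b - ⟨b, x⟩ a)`. -/
def wedgeToSo : ⋀[ℝ]^2 V →ₗ[ℝ] so V := exteriorPower.alternatingMapLinearEquiv wedgeAlt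

theorem wedgeToSo_ιMulti (v : Fin 2 → V) :
    wedgeToSo (exteriorPower.ιMulti ℝ 2 v) = wedgeEnd (v 0) (v 1) :=
  exteriorPower.alternatingMapLinearEquiv_apply_ιMulti _ _

theorem wedgeEnd_swap (a b : V) : wedgeEnd b a = -wedgeEnd a b := by
  apply Subtype.ext
  ext x
  change ((wedgeEnd b a : so V) : Module.End ℝ V) x = -((wedgeEnd a b : so V) : Module.End ℝ V) x
  rw [wedgeEnd_apply, wedgeEnd_apply, neg_sub]

theorem update_pair {X : Type*} [Zero X] (b z : X) : Function.update ![0, b] 0 z = ![z, b] := by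
  ext i
  fin_cases i <;> rfl

/-- The linear map `a ↦ a ∧ b` to `Λ² V`. -/
def wedgeLeft (b : V) : V →ₗ[ℝ] ⋀[ℝ]^2 V where
  toFun a := exteriorPower.ιMulti ℝ 2 ![a, b]
  map_add' x y := by
    have hu : ∀ z : V, Function.update ![0, b] 0 z = ![z, b] := update_pair b
    have h := (exteriorPower.ιMulti ℝ 2 (M := V)).map_update_add ![0, b] 0 x y
    rw [hu, hu, hu] at h
    exact h
  map_smul' c x := by
    have hu : ∀ z : V, Function.update ![0, b] 0 z = ![z, b] := update_pair b
    have h := (exteriorPower.ιMulti ℝ 2 (M := V)).map_update_smul ![0, b] 0 c x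
    rw [hu, hu] at h
    exact h

theorem wedge_swap (a b : V) :
    exteriorPower.ιMulti ℝ 2 ![b, a] = -exteriorPower.ιMulti ℝ 2 ![a, b] := by
  have h := (exteriorPower.ιMulti ℝ 2 (M := V)).map_swap ![a, b] (i := 0) (j := 1) (by decide)
  rw [← h]
  congr 1
  ext i
  fin_cases i <;> rfl

section Equiv

variable [FiniteDimensional ℝ V]

/-- The inverse `A ↦ ½ ∑ᵢ bᵢ ∧ A bᵢ` of `wedgeToSo`, for an orthonormal basis `(bᵢ)`. -/
def soToWedge : so V →ₗ[ℝ] ⋀[ℝ]^2 V :=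
  (1 / 2 : ℝ) • ∑ i, -(wedgeLeft (stdOrthonormalBasis ℝ V i) ∘ₗ
    LinearMap.applyₗ (stdOrthonormalBasis ℝ V i) ∘ₗ (so V).toSubmodule.subtype)

theorem soToWedge_apply (A : so V) :
    soToWedge A = (1 / 2 : ℝ) • ∑ i, exteriorPower.ιMulti ℝ 2
      ![stdOrthonormalBasis ℝ V i, (A : Module.End ℝ V) (stdOrthonormalBasis ℝ V i)] := by
  simp only [soToWedge, LinearMap.smul_apply, LinearMap.sum_apply, LinearMap.neg_apply]
  congr 1
  refine Finset.sum_congr rfl fun i _ => ?_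
  rw [wedge_swap]
  rfl

theorem soToWedge_wedgeEnd (a b : V) :
    soToWedge (wedgeEnd a b) = exteriorPower.ιMulti ℝ 2 ![a, b] := by
  have hsum : ∀ c d : V, ∑ i, inner ℝ c (stdOrthonormalBasis ℝ V i) •
      wedgeLeft d (stdOrthonormalBasis ℝ V i) = wedgeLeft d c := by
    intro c d
    conv_rhs => rw [← (stdOrthonormalBasis ℝ V).sum_repr' c, map_sum]
    refine Finset.sum_congr rfl fun i _ => ?_
    rw [map_smul, real_inner_comm]
  have h1 : ∀ i, exteriorPower.ιMulti ℝ 2 ![stdOrthonormalBasis ℝ V i,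
      ((wedgeEnd a b : so V) : Module.End ℝ V) (stdOrthonormalBasis ℝ V i)] =
      inner ℝ a (stdOrthonormalBasis ℝ V i) • wedgeLeft b (stdOrthonormalBasis ℝ V i) -
      inner ℝ b (stdOrthonormalBasis ℝ V i) • wedgeLeft a (stdOrthonormalBasis ℝ V i) := by
    intro i
    rw [wedge_swap]
    change -(wedgeLeft _ _) = _
    rw [wedgeEnd_apply, map_sub, map_smul, map_smul]
    have h2 : ∀ c d : V, wedgeLeft c d = -wedgeLeft d c := fun c d => wedge_swap c d
    rw [h2 _ a, h2 _ b]
    simp only [smul_neg]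
    abel
  rw [soToWedge_apply]
  simp_rw [h1]
  rw [Finset.sum_sub_distrib, hsum, hsum]
  have h2 : wedgeLeft a b = -wedgeLeft b a := wedge_swap a b
  rw [h2, sub_neg_eq_add, ← two_smul ℝ, smul_smul]
  norm_num
  rfl

theorem wedgeToSo_soToWedge (A : so V) : wedgeToSo (soToWedge A) = A := by
  have hA := mem_so.1 A.2
  rw [soToWedge_apply, map_smul, map_sum]
  simp only [wedgeToSo_ιMulti, Matrix.cons_val_zero, Matrix.cons_val_one]
  apply Subtype.ext
  ext x
  have hx : ∑ i, inner ℝ (stdOrthonormalBasis ℝ V i) x •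
      (A : Module.End ℝ V) (stdOrthonormalBasis ℝ V i) = (A : Module.End ℝ V) x := by
    conv_rhs => rw [← (stdOrthonormalBasis ℝ V).sum_repr' x, map_sum]
    simp
  have hx' : ∑ i, inner ℝ ((A : Module.End ℝ V) (stdOrthonormalBasis ℝ V i)) x •
      stdOrthonormalBasis ℝ V i = -(A : Module.End ℝ V) x := by
    conv_rhs => rw [← (stdOrthonormalBasis ℝ V).sum_repr' ((A : Module.End ℝ V) x)]
    rw [← Finset.sum_neg_distrib]
    refine Finset.sum_congr rfl fun i _ => ?_
    rw [hA, neg_smul]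
  have hcoe : ((∑ i, wedgeEnd (stdOrthonormalBasis ℝ V i)
      ((A : Module.End ℝ V) (stdOrthonormalBasis ℝ V i)) : so V) : Module.End ℝ V) x =
      (2 : ℝ) • (A : Module.End ℝ V) x := by
    have := map_sum (so V).toSubmodule.subtype (fun i => wedgeEnd (stdOrthonormalBasis ℝ V i)
      ((A : Module.End ℝ V) (stdOrthonormalBasis ℝ V i))) Finset.univ
    change (so V).toSubmodule.subtype _ x = _
    rw [this, LinearMap.sum_apply]
    change ∑ i, ((wedgeEnd _ _ : so V) : Module.End ℝ V) x = _
    simp only [wedgeEnd_apply]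
    rw [Finset.sum_sub_distrib, hx, hx', two_smul, sub_neg_eq_add]
  change (1 / 2 : ℝ) • ((∑ i, wedgeEnd (stdOrthonormalBasis ℝ V i)
      ((A : Module.End ℝ V) (stdOrthonormalBasis ℝ V i)) : so V) : Module.End ℝ V) x = _
  rw [hcoe, smul_smul]
  norm_num

variable (V) in
/-- The standard isomorphism `Λ² V ≅ so(V)`, `a ∧ b ↦ (x ↦ ⟨a, x⟩ b - ⟨b, x⟩ a)`. -/
def wedgeEquivSo : ⋀[ℝ]^2 V ≃ₗ[ℝ] so V :=
  LinearEquiv.ofLinearMap wedgeToSo soToWedge (LinearMap.ext wedgeToSo_soToWedge) (by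
    apply exteriorPower.linearMap_ext
    ext v
    change ((soToWedge (wedgeToSo (exteriorPower.ιMulti ℝ 2 v)) : ⋀[ℝ]^2 V) :
      ExteriorAlgebra ℝ V) = (exteriorPower.ιMulti ℝ 2 v : ⋀[ℝ]^2 V)
    rw [wedgeToSo_ιMulti, soToWedge_wedgeEnd]
    congr 2
    ext i
    fin_cases i <;> rfl)

end Equiv

end Euclidean

/-! ### Representations -/

/-- A representation of the even Clifford algebra `Cl_r⁰` on a Euclidean space `V` in which every
bivector `eᵢ eⱼ`, `i < j`, acts by a skew-adjoint endomorphism; in other words, a real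
representation of `Cl_r⁰` with a `Spin(r)`-invariant inner product. -/
structure EuclideanRep (r : ℕ) (V : Type*) [NormedAddCommGroup V] [InnerProductSpace ℝ V] where
  /-- The action of `Cl_r⁰`. -/
  toAlgHom : ClEven r →ₐ[ℝ] Module.End ℝ V
  /-- Bivectors act by skew-adjoint endomorphisms. -/
  skew : ∀ i j : Fin r, i < j → toAlgHom (bivector r i j) ∈ so V

namespace EuclideanRep

variable {r : ℕ} {V W : Type*} [NormedAddCommGroup V] [InnerProductSpace ℝ V]
  [NormedAddCommGroup W] [InnerProductSpace ℝ W]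

/-- Irreducibility as a representation of `Cl_r⁰`. -/
def IsIrreducible (ρ : EuclideanRep r V) : Prop :=
  Nontrivial V ∧ ∀ U : Submodule ℝ V, (∀ a : ClEven r, ∀ v ∈ U, ρ.toAlgHom a v ∈ U) →
    U = ⊥ ∨ U = ⊤

/-- Isomorphism of representations of `Cl_r⁰`. -/
def IsIsomorphic (ρ : EuclideanRep r V) (τ : EuclideanRep r W) : Prop :=
  ∃ f : V ≃ₗ[ℝ] W, ∀ (a : ClEven r) (v : V), f (ρ.toAlgHom a v) = τ.toAlgHom a (f v)

theorem map_spin_mem_so (ρ : EuclideanRep r V) {x : ClEven r} (hx : x ∈ spin r) :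
    ρ.toAlgHom x ∈ so V := by
  change x ∈ spinSpan r at hx
  induction hx using Submodule.span_induction with
  | mem x hx =>
    obtain ⟨i, j, hij, rfl⟩ := hx
    exact ρ.skew i j hij
  | zero => rw [map_zero]; exact zero_mem _
  | add x y _ _ hx hy => rw [map_add]; exact add_mem hx hy
  | smul c x _ hx => rw [map_smul]; exact (so V).smul_mem c hx

/-- The homomorphism of Lie algebras `spin(r) → so(V)`. -/
def spinToSo (ρ : EuclideanRep r V) : spin r →ₗ⁅ℝ⁆ so V where
  toFun x := ⟨ρ.toAlgHom x, ρ.map_spin_mem_so x.2⟩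
  map_add' x y := Subtype.ext (map_add ρ.toAlgHom (x : ClEven r) y)
  map_smul' c x := Subtype.ext (map_smul ρ.toAlgHom.toLinearMap c (x : ClEven r))
  map_lie' := by
    intro x y
    apply Subtype.ext
    change ρ.toAlgHom ((x : ClEven r) * y - y * x) =
      ρ.toAlgHom x * ρ.toAlgHom y - ρ.toAlgHom y * ρ.toAlgHom x
    rw [map_sub, map_mul, map_mul]

/-- The centralizer of (the image of) `spin(r)` in `so(V)`. -/
def spinCentralizer (ρ : EuclideanRep r V) : LieSubalgebra ℝ (so V) :=
  lieCentralizer ρ.spinToSo.range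

/-- The centralizer of (the diagonal image of) `spin(r)` in `so(V) ⊕ so(W)`. -/
def spinCentralizer₂ (ρ : EuclideanRep r V) (τ : EuclideanRep r W) :
    LieSubalgebra ℝ (so V × so W) :=
  lieCentralizer (ρ.spinToSo.prod τ.spinToSo).range

/-- The representation of the group `Spin(r)` on `V`. -/
def spinRep (ρ : EuclideanRep r V) : Representation ℝ (Spin r) V where
  toFun g := ρ.toAlgHom ⟨g, spinGroup.mem_even g.2⟩
  map_one' := map_one ρ.toAlgHom
  map_mul' g h := map_mul ρ.toAlgHom ⟨g, spinGroup.mem_even g.2⟩ ⟨h, spinGroup.mem_even h.2⟩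

/-- The representation of `Spin(r)` on `Λ² V`. -/
def extSqRep (ρ : EuclideanRep r V) : Representation ℝ (Spin r) (⋀[ℝ]^2 V) where
  toFun g := exteriorPower.map 2 (ρ.spinRep g)
  map_one' := by rw [map_one]; exact exteriorPower.map_id
  map_mul' g h := by
    rw [map_mul, Module.End.mul_eq_comp, Module.End.mul_eq_comp, exteriorPower.map_comp]

/-- The `Spin(r)`-invariants of `Λ² V`, that is its largest trivial subrepresentation. -/
def extSqInvariants (ρ : EuclideanRep r V) : Submodule ℝ (⋀[ℝ]^2 V) :=
  ρ.extSqRep.invariants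

/-- The `Spin(r)`-invariants of `Sym₀² V`, that is its largest trivial subrepresentation. The group
acts on endomorphisms by conjugation. -/
def symZeroInvariants (ρ : EuclideanRep r V) : Submodule ℝ (Module.End ℝ V) :=
  symZero V ⊓ (Representation.linHom ρ.spinRep ρ.spinRep).invariants

/-- The `Spin(r)`-invariants of `V ⊗ W`, that is its largest trivial subrepresentation. -/
def tensorInvariants (ρ : EuclideanRep r V) (τ : EuclideanRep r W) : Submodule ℝ (V ⊗[ℝ] W) :=
  (Representation.tprod ρ.spinRep τ.spinRep).invariants

end EuclideanRep

end SpinCentralizer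

end

/-!
The theorem is a computation of a real Frobenius-Schur indicator; neither the classification of
the algebras `Cl_r⁰` nor the dimension of their irreducible representations is needed.

Since `spin(r)` generates `Cl_r⁰` as an algebra, and so do the elements `eᵢ eⱼ` of `Spin(r)`,
commuting with the Lie algebra, with the group and with `Cl_r⁰` are the same thing. Let `D` be the
commutant of `Cl_r⁰` in `End V`, for `V` irreducible. It is stable under `A ↦ A*`, and by the
spectral theorem its symmetric elements are scalars (`IsIrreducible.hasScalarSymmetricPart`), which
settles `Sym₀²`. The centralizer of `spin(r)` in `so(V)` is the skew part `K` of `D`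
(`spinCentralizer_eq_skewPart`), and `Λ² V ≅ so(V)` carries the invariants of `Λ² V` onto it,
because `Spin(r)` acts orthogonally (`map_extSqInvariants`). As `D = ℝ ⊕ K` and squares of elements
of `K` are non-positive scalars, `K` is `0`, a line, or `{aI + bJ + cIJ}` for a quaternionic pair
`I`, `J` (`exists_quaternion_basis`), that is `0`, `u(1)` or `sp(1)`. Only `dim K` remains to be found.

Put `n = r - 1`. The `n` elements `eᵢ eᵣ`, `i < r`, generate `Cl_r⁰`, anticommute, and have square
`-1`. Let `g` run over the `2ⁿ` ordered products of their images in `End V`. The operator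
`A ↦ ∑ g A* g*` has trace `∑ tr (g²)`. It also maps `End V` to `D` and acts on `D` as `2ⁿ` times
`A ↦ A*`, whose trace on `D = ℝ ⊕ K` is `1 - dim K`. Each `g²` is `±1`, and adding the signs gives
`2ⁿ (1 - dim K) = Re ((1 + i)ʳ) dim V` (`IsIrreducible.finrank_spinCentralizer`). The sign of
`Re ((1 + i)ʳ)` depends on `r` modulo `8` only, and decides between `dim K < 1`, `dim K = 1` and
`dim K > 1`.

The centralizer in `so(V) ⊕ so(W)` is the product of the two centralizers, and `V ⊗ W ≅ Hom(V, W)`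
turns invariants into intertwining maps, which vanish by Schur's lemma.
-/

namespace SpinCentralizer

/-! ### Endomorphisms of a Euclidean space -/

section Trace

variable {V : Type*} [NormedAddCommGroup V] [InnerProductSpace ℝ V] [FiniteDimensional ℝ V]

theorem star_smul_end (c : ℝ) (A : Module.End ℝ V) : star (c • A) = c • star A := by
  simp

theorem mem_so_iff_star {A : Module.End ℝ V} : A ∈ so V ↔ star A = -A := by
  rw [mem_so, LinearMap.star_eq_adjoint, eq_comm, LinearMap.eq_adjoint_iff]
  simp [neg_eq_iff_eq_neg]

theorem isSymmetric_iff_star {A : Module.End ℝ V} : A.IsSymmetric ↔ star A = A :=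
  LinearMap.isSymmetric_iff_isSelfAdjoint A

variable (V) in
/-- The linear map `A ↦ A*` on endomorphisms. -/
noncomputable def starEnd : Module.End ℝ V →ₗ[ℝ] Module.End ℝ V where
  toFun A := star A
  map_add' := star_add
  map_smul' := star_smul_end

/-- The linear map `A ↦ a A b` on endomorphisms. -/
noncomputable def sandwich (a b : Module.End ℝ V) : Module.End ℝ V →ₗ[ℝ] Module.End ℝ V :=
  LinearMap.mulLeft ℝ a ∘ₗ LinearMap.mulRight ℝ b

theorem trace_mul_transpose_mul (n : Type*) [Fintype n] [DecidableEq n] (h : Matrix n n ℝ)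
    (L : Matrix n n ℝ →ₗ[ℝ] Matrix n n ℝ) (hL : ∀ A, L A = h * A.transpose * h.transpose) :
    LinearMap.trace ℝ _ L = (h * h).trace := by
  rw [LinearMap.trace_eq_matrix_trace ℝ (Matrix.stdBasis ℝ n n), Matrix.trace,
    Fintype.sum_prod_type, Matrix.trace]
  refine Finset.sum_congr rfl fun i _ => ?_
  rw [Matrix.diag_apply, Matrix.mul_apply]
  refine Finset.sum_congr rfl fun j _ => ?_
  rw [Matrix.diag_apply, LinearMap.toMatrix_apply, Matrix.stdBasis_eq_single, hL]
  simp [Matrix.stdBasis, Matrix.mul_apply, Matrix.transpose_single, Matrix.single_apply]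
  simp [ite_and]

/-- The operator `A ↦ h A* h*` on `End V` has trace `tr (h²)`: in terms of matrices, its diagonal
entry at the `(i, j)`-th matrix unit is `hᵢⱼ hⱼᵢ`. -/
theorem trace_sandwich_starEnd (h : Module.End ℝ V) :
    LinearMap.trace ℝ _ (sandwich h (star h) ∘ₗ starEnd V) = LinearMap.trace ℝ V (h * h) := by
  let b := stdOrthonormalBasis ℝ V
  let φ := LinearMap.toMatrixOrthonormal b
  let e : Module.End ℝ V ≃ₗ[ℝ] Matrix _ _ ℝ := φ.toAlgEquiv.toLinearEquiv
  have he : ∀ A, e A = φ A := fun _ => rfl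
  rw [← LinearMap.trace_conj' _ e, trace_mul_transpose_mul _ (φ h), ← map_mul,
    LinearMap.trace_eq_matrix_trace ℝ b.toBasis]
  · rfl
  · intro A
    obtain ⟨A, rfl⟩ := e.surjective A
    rw [LinearEquiv.conj_apply_apply, e.symm_apply_apply, he, he]
    simp only [sandwich, starEnd, LinearMap.comp_apply, LinearMap.mulLeft_apply,
      LinearMap.mulRight_apply, LinearMap.coe_mk, AddHom.coe_mk]
    rw [map_mul, map_mul, map_star, map_star, Matrix.star_eq_conjTranspose,
      Matrix.star_eq_conjTranspose, Matrix.conjTranspose_eq_transpose_of_trivial,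
      Matrix.conjTranspose_eq_transpose_of_trivial, mul_assoc]

end Trace

/-! ### Averaging over Clifford monomials -/

section Twirl

variable {V : Type*} [NormedAddCommGroup V] [InnerProductSpace ℝ V] [FiniteDimensional ℝ V]

/-- The endomorphisms `f 0, …, f (n - 1)` are skew-adjoint, anticommute and have square `-1`. The
values of `f` from `n` on are irrelevant. -/
structure IsCliffordFamily (n : ℕ) (f : ℕ → Module.End ℝ V) : Prop where
  sq : ∀ i < n, f i * f i = -1
  anticomm : ∀ i < n, ∀ j < n, i ≠ j → f i * f j = -(f j * f i)
  skew : ∀ i < n, star (f i) = -f i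

/-- The operator `A ↦ ∑ g A g*` on `End V`, where `g` runs over the `2ᵏ` ordered products of
distinct elements of the skew-adjoint family `f 0, …, f (k - 1)`; the minus sign in the
recursion comes from `(f k)* = -f k`. -/
noncomputable def twirl (f : ℕ → Module.End ℝ V) : ℕ → Module.End ℝ V →ₗ[ℝ] Module.End ℝ V
  | 0 => LinearMap.id
  | k + 1 => twirl f k - sandwich (f k) (f k) ∘ₗ twirl f k

omit [FiniteDimensional ℝ V] in
theorem twirl_succ (f : ℕ → Module.End ℝ V) (k : ℕ) (A : Module.End ℝ V) :
    twirl f (k + 1) A = twirl f k A - f k * (twirl f k A * f k) := rfl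

omit [FiniteDimensional ℝ V] in
theorem twirl_zero (f : ℕ → Module.End ℝ V) (A : Module.End ℝ V) : twirl f 0 A = A := rfl

variable {n : ℕ} {f : ℕ → Module.End ℝ V}

theorem IsCliffordFamily.twirl_commutes (hf : IsCliffordFamily n f) {k : ℕ} (hk : k ≤ n)
    (A : Module.End ℝ V) : ∀ i < k, twirl f k A * f i = f i * twirl f k A := by
  induction k with
  | zero => intro i hi; omega
  | succ k ih =>
    intro i hi
    rw [twirl_succ]
    set B := twirl f k A
    rcases Nat.lt_succ_iff_lt_or_eq.1 hi with hi | rfl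
    · have hB : B * f i = f i * B := ih (by omega) i hi
      have hki : f k * f i = -(f i * f k) := hf.anticomm k (by omega) i (by omega) (by omega)
      have : f k * (B * f k) * f i = f i * (f k * (B * f k)) := by
        calc f k * (B * f k) * f i = f k * (B * (f k * f i)) := by simp only [mul_assoc]
          _ = -(f k * (B * f i) * f k) := by rw [hki]; simp only [mul_neg, mul_assoc]
          _ = -((f k * f i) * B * f k) := by rw [hB]; simp only [mul_assoc]
          _ = f i * (f k * (B * f k)) := by rw [hki]; simp only [neg_mul, neg_neg, mul_assoc]
      rw [sub_mul, mul_sub, hB, this]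
    · have hs := hf.sq i (by omega)
      have h1 : f i * (B * f i) * f i = -(f i * B) := by
        rw [mul_assoc, mul_assoc, hs]; simp
      have h2 : f i * (f i * (B * f i)) = -(B * f i) := by
        rw [← mul_assoc, hs]; simp
      rw [sub_mul, mul_sub, h1, h2]
      abel

theorem IsCliffordFamily.twirl_of_commutes (hf : IsCliffordFamily n f) {k : ℕ} (hk : k ≤ n)
    {A : Module.End ℝ V} (hA : ∀ i < k, A * f i = f i * A) :
    twirl f k A = (2 : ℝ) ^ k • A := by
  induction k with
  | zero => simp [twirl_zero]
  | succ k ih =>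
    rw [twirl_succ, ih (by omega) fun i hi => hA i (by omega), smul_mul_assoc, mul_smul_comm,
      hA k (by omega), ← mul_assoc, hf.sq k (by omega), neg_one_mul, pow_succ, mul_smul, two_smul]
    simp [smul_add]

theorem IsCliffordFamily.twirl_sandwich (hf : IsCliffordFamily n f) {k m : ℕ} (hk : k ≤ m)
    (hm : m < n) (A : Module.End ℝ V) :
    twirl f k (f m * (A * f m)) = f m * (twirl f k A * f m) := by
  induction k with
  | zero => rfl
  | succ k ih =>
    rw [twirl_succ, twirl_succ, ih (by omega)]
    have hkm : f k * f m = -(f m * f k) := hf.anticomm k (by omega) m (by omega) (by omega)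
    have hmk : f m * f k = -(f k * f m) := hf.anticomm m (by omega) k (by omega) (by omega)
    set B := twirl f k A
    have : f k * (f m * (B * f m) * f k) = f m * (f k * (B * f k) * f m) := by
      calc f k * (f m * (B * f m) * f k) = (f k * f m) * B * (f m * f k) := by
            simp only [mul_assoc]
        _ = -(f m * f k) * B * -(f k * f m) := by rw [← hkm, ← hmk]
        _ = f m * (f k * (B * f k) * f m) := by simp only [neg_mul, mul_neg, neg_neg, mul_assoc]
    rw [this, sub_mul, mul_sub]

/-- The pair of `∑ ε(g)` and `∑ (-1)^(deg g) ε(g)`, where `g` runs over the ordered products of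
distinct elements among `k` anticommuting square roots of `-1`, and `ε(g) = g² = ±1`. It consists of
the real and imaginary part of `(1 + i)^(k + 1)`. -/
def squareSignSums : ℕ → ℤ × ℤ
  | 0 => (1, 1)
  | k + 1 =>
    ((squareSignSums k).1 - (squareSignSums k).2, (squareSignSums k).2 + (squareSignSums k).1)

/-- The trace of `A ↦ ∑ (g h) A* (g h)*` is `∑ tr ((g h)²)`. The two statements, for `h` commuting
and for `h` anticommuting with the generators, are proved together: splitting off the last generator
`f k` replaces `h` by `f k * h`, which exchanges the two cases. -/
theorem IsCliffordFamily.trace_twirl (hf : IsCliffordFamily n f) {k : ℕ} (hk : k ≤ n)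
    (h : Module.End ℝ V) :
    ((∀ i < k, h * f i = f i * h) →
      LinearMap.trace ℝ _ (twirl f k ∘ₗ sandwich h (star h) ∘ₗ starEnd V) =
        (squareSignSums k).1 * LinearMap.trace ℝ V (h * h)) ∧
    ((∀ i < k, h * f i = -(f i * h)) →
      LinearMap.trace ℝ _ (twirl f k ∘ₗ sandwich h (star h) ∘ₗ starEnd V) =
        (squareSignSums k).2 * LinearMap.trace ℝ V (h * h)) := by
  induction k generalizing h with
  | zero => simp [squareSignSums, twirl, trace_sandwich_starEnd]
  | succ k ih =>
    have hrec : twirl f (k + 1) ∘ₗ sandwich h (star h) ∘ₗ starEnd V =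
        twirl f k ∘ₗ sandwich h (star h) ∘ₗ starEnd V +
        twirl f k ∘ₗ sandwich (f k * h) (star (f k * h)) ∘ₗ starEnd V := by
      ext1 A
      simp only [LinearMap.add_apply, LinearMap.comp_apply]
      rw [twirl_succ, ← hf.twirl_sandwich le_rfl (by omega), sub_eq_add_neg, ← map_neg]
      congr 2
      change -(f k * (h * (star A * star h) * f k)) = f k * h * (star A * star (f k * h))
      rw [star_mul, hf.skew k (by omega)]
      simp only [mul_neg, mul_assoc]
    have hsq := hf.sq k (by omega)
    have hanti : ∀ i < k, f k * f i = -(f i * f k) := fun i hi =>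
      hf.anticomm k (by omega) i (by omega) (by omega)
    rw [hrec, map_add]
    constructor
    · intro hh
      have h2 : f k * h * (f k * h) = -(h * h) := by
        calc f k * h * (f k * h) = f k * (h * f k) * h := by simp only [mul_assoc]
          _ = (f k * f k) * (h * h) := by rw [hh k (by omega)]; simp only [mul_assoc]
          _ = _ := by rw [hsq, neg_one_mul]
      rw [(ih (by omega) h).1 fun i hi => hh i (by omega), (ih (by omega) (f k * h)).2 ?_, h2]
      · simp only [squareSignSums, map_neg]; push_cast; ring
      · intro i hi
        rw [mul_assoc, hh i (by omega), ← mul_assoc, hanti i hi, neg_mul, mul_assoc]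
    · intro hh
      have h2 : f k * h * (f k * h) = h * h := by
        calc f k * h * (f k * h) = f k * (h * f k) * h := by simp only [mul_assoc]
          _ = -((f k * f k) * (h * h)) := by
            rw [hh k (by omega)]; simp only [mul_assoc, mul_neg, neg_mul]
          _ = _ := by rw [hsq, neg_one_mul, neg_neg]
      rw [(ih (by omega) h).2 fun i hi => hh i (by omega), (ih (by omega) (f k * h)).1 ?_, h2]
      · simp only [squareSignSums]; push_cast; ring
      · intro i hi
        rw [mul_assoc, hh i (by omega), mul_neg, ← mul_assoc, hanti i hi, neg_mul, neg_neg,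
          mul_assoc]

theorem squareSignSums_add_eight (k : ℕ) :
    squareSignSums (k + 8) = (16 * (squareSignSums k).1, 16 * (squareSignSums k).2) := by
  simp only [squareSignSums, Prod.mk.injEq]
  constructor <;> ring

theorem squareSignSums_add_eight_mul (m q : ℕ) :
    (squareSignSums (m + 8 * q)).1 = 16 ^ q * (squareSignSums m).1 := by
  induction q with
  | zero => simp
  | succ q ih =>
    rw [show m + 8 * (q + 1) = m + 8 * q + 8 by ring, squareSignSums_add_eight, ih, pow_succ]
    ring

theorem sign_squareSignSums (k : ℕ) :
    SignType.sign (squareSignSums k).1 = SignType.sign (squareSignSums (k % 8)).1 := by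
  conv_lhs => rw [← Nat.mod_add_div k 8, squareSignSums_add_eight_mul, sign_mul]
  rw [sign_pos (by positivity), one_mul]

end Twirl

/-! ### Star-closed subalgebras whose symmetric elements are scalars -/

section StarSubalgebra

variable {V : Type*} [NormedAddCommGroup V] [InnerProductSpace ℝ V] [FiniteDimensional ℝ V]

/-- On a subspace `P` as in the statement, `A ↦ A*` is `A ↦ (2 tr A / dim V) • 1 - A`. -/
theorem trace_restrict_starEnd [Nontrivial V] {P : Submodule ℝ (Module.End ℝ V)} (h1 : 1 ∈ P)
    (hstar : ∀ A ∈ P, star A ∈ P) (hsymm : ∀ A ∈ P, star A = A → ∃ c : ℝ, A = c • 1) :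
    LinearMap.trace ℝ P ((starEnd V).restrict hstar) = 2 - Module.finrank ℝ P := by
  have hV : (Module.finrank ℝ V : ℝ) ≠ 0 := by
    exact_mod_cast (Module.finrank_pos (R := ℝ) (M := V)).ne'
  have h : (starEnd V).restrict hstar =
      ((2 / Module.finrank ℝ V : ℝ) • (LinearMap.trace ℝ V ∘ₗ P.subtype)).smulRight
        (⟨1, h1⟩ : P) + (-1 : ℝ) • LinearMap.id := by
    ext1 A
    apply Subtype.ext
    change star (A : Module.End ℝ V) =
      (2 / Module.finrank ℝ V * LinearMap.trace ℝ V (A : Module.End ℝ V)) • 1 + (-1 : ℝ) • A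
    obtain ⟨c, hc⟩ := hsymm (A + star (A : Module.End ℝ V))
      (add_mem A.2 (hstar _ A.2)) (by rw [star_add, star_star, add_comm])
    have htr : LinearMap.trace ℝ V (star (A : Module.End ℝ V)) =
        LinearMap.trace ℝ V (A : Module.End ℝ V) := by
      rw [LinearMap.trace_eq_sum_inner _ (stdOrthonormalBasis ℝ V),
        LinearMap.trace_eq_sum_inner _ (stdOrthonormalBasis ℝ V), LinearMap.star_eq_adjoint]
      exact Finset.sum_congr rfl fun i _ => by
        rw [LinearMap.adjoint_inner_right, real_inner_comm]
    have h2 := congrArg (LinearMap.trace ℝ V) hc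
    rw [map_add, htr, map_smul, LinearMap.trace_one, smul_eq_mul] at h2
    have h3 : 2 / Module.finrank ℝ V * LinearMap.trace ℝ V (A : Module.End ℝ V) = c := by
      field_simp
      linarith
    rw [h3, ← hc]
    module
  rw [h, map_add, map_smul, LinearMap.trace_smulRight, LinearMap.trace_id, smul_eq_mul,
    neg_one_mul, ← sub_eq_add_neg]
  congr 1
  change 2 / (Module.finrank ℝ V : ℝ) * LinearMap.trace ℝ V 1 = 2
  rw [LinearMap.trace_one]
  field_simp

/-- The subalgebra `D` of `End V` is closed under adjoints, and its symmetric elements are scalars.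
For `V ≠ 0` it is then a copy of `ℝ`, `ℂ` or `ℍ`. -/
structure HasScalarSymmetricPart (D : Subalgebra ℝ (Module.End ℝ V)) : Prop where
  star_mem : ∀ A ∈ D, star A ∈ D
  eq_smul_one : ∀ A ∈ D, star A = A → ∃ c : ℝ, A = c • 1

/-- The Lie algebra of skew-adjoint elements of a subalgebra of `End V`, inside `so(V)`. -/
noncomputable def skewPart (D : Subalgebra ℝ (Module.End ℝ V)) : LieSubalgebra ℝ (so V) :=
  (lieSubalgebraOfSubalgebra ℝ _ D).comap (so V).incl

omit [FiniteDimensional ℝ V] in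
theorem mem_skewPart {D : Subalgebra ℝ (Module.End ℝ V)} {x : so V} :
    x ∈ skewPart D ↔ (x : Module.End ℝ V) ∈ D := Iff.rfl

namespace HasScalarSymmetricPart

variable {D : Subalgebra ℝ (Module.End ℝ V)} (hD : HasScalarSymmetricPart D) [Nontrivial V]

include hD

/-- `D` is the direct sum of the scalars and its skew part. -/
theorem finrank_skewPart : Module.finrank ℝ (skewPart D) + 1 = Module.finrank ℝ D := by
  let g : skewPart D × ℝ →ₗ[ℝ] D :=
    LinearMap.coprod
      { toFun := fun x => ⟨x.1, mem_skewPart.1 x.2⟩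
        map_add' := fun _ _ => rfl
        map_smul' := fun _ _ => rfl } (Algebra.linearMap ℝ D)
  have hg : ∀ x c, (g (x, c) : Module.End ℝ V) = (x : so V) + c • 1 := fun x c => by
    rw [← Algebra.algebraMap_eq_smul_one]; rfl
  have hb : Function.Bijective g := by
    constructor
    · rw [injective_iff_map_eq_zero]
      rintro ⟨x, c⟩ hx
      have h1 : ((x : so V) : Module.End ℝ V) + c • 1 = 0 := by rw [← hg, hx]; rfl
      have h2 : -((x : so V) : Module.End ℝ V) + c • 1 = 0 := by
        have := congrArg star h1
        rwa [star_add, star_smul_end, star_one, mem_so_iff_star.1 (x : so V).2, star_zero] at this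
      have h3 : (2 * c) • (1 : Module.End ℝ V) = 0 := by
        linear_combination (norm := module) h1 + h2
      have h4 : c = 0 := by simpa using h3
      rw [h4, zero_smul, add_zero] at h1
      rw [h4]
      exact Prod.ext (Subtype.ext (Subtype.ext h1)) rfl
    · rintro ⟨A, hA⟩
      obtain ⟨c, hc⟩ := hD.eq_smul_one (A + star A) (add_mem hA (hD.star_mem A hA))
        (by rw [star_add, star_star, add_comm])
      have hs : (2⁻¹ : ℝ) • (A - star A) ∈ so V := by
        rw [mem_so_iff_star, star_smul_end, star_sub, star_star]
        module
      refine ⟨(⟨⟨_, hs⟩, D.smul_mem (sub_mem hA (hD.star_mem A hA)) _⟩, c / 2), Subtype.ext ?_⟩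
      rw [hg]
      change (2⁻¹ : ℝ) • (A - star A) + (c / 2) • 1 = A
      linear_combination (norm := module) (-(1 / 2) : ℝ) • hc
  rw [← (LinearEquiv.ofBijective g hb).finrank_eq, Module.finrank_prod, Module.finrank_self]

/-- The indicator formula: both sides are the trace of `A ↦ ∑ g A* g*`, computed on its image `D`
and on `End V`. -/
theorem finrank_skewPart_eq {n : ℕ} {f : ℕ → Module.End ℝ V} (hf : IsCliffordFamily n f)
    (hDf : ∀ A, A ∈ D ↔ ∀ i < n, A * f i = f i * A) :
    (2 : ℝ) ^ n * (1 - Module.finrank ℝ (skewPart D)) =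
      (squareSignSums n).1 * Module.finrank ℝ V := by
  have h1 := (hf.trace_twirl le_rfl 1).1 (by simp)
  rw [mul_one, LinearMap.trace_one] at h1
  rw [← h1]
  have hS : ∀ A, (twirl f n ∘ₗ sandwich 1 (star 1) ∘ₗ starEnd V) A = twirl f n (star A) := by
    intro A
    simp [sandwich, starEnd]
  have hmem : ∀ A, (twirl f n ∘ₗ sandwich 1 (star 1) ∘ₗ starEnd V) A ∈
      Subalgebra.toSubmodule D := by
    intro A
    rw [hS]
    exact (hDf _).2 (hf.twirl_commutes le_rfl _)
  rw [← LinearMap.trace_restrict_eq_of_forall_mem _ _ hmem]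
  have h2 : (twirl f n ∘ₗ sandwich 1 (star 1) ∘ₗ starEnd V).restrict (fun A _ => hmem A) =
      (2 : ℝ) ^ n • (starEnd V).restrict (p := Subalgebra.toSubmodule D) hD.star_mem := by
    ext1 A
    apply Subtype.ext
    refine (hS A).trans (hf.twirl_of_commutes le_rfl ((hDf _).1 (hD.star_mem _ A.2)))
  rw [h2, map_smul]
  refine Eq.trans ?_ (congrArg _ (trace_restrict_starEnd D.one_mem hD.star_mem hD.eq_smul_one).symm)
  rw [Subalgebra.finrank_toSubmodule, ← hD.finrank_skewPart, smul_eq_mul]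
  push_cast
  ring

omit [Nontrivial V] in
theorem exists_smul_sq_eq_neg_one {x : Module.End ℝ V} (hx : x ∈ D) (hs : star x = -x)
    (h0 : x ≠ 0) : ∃ t : ℝ, (t • x) * (t • x) = -1 := by
  obtain ⟨c, hc⟩ := hD.eq_smul_one (x * x) (mul_mem hx hx) (by rw [star_mul, hs, neg_mul_neg])
  obtain ⟨v, hv⟩ : ∃ v, x v ≠ 0 := by
    by_contra! h
    exact h0 (LinearMap.ext h)
  have hv0 : v ≠ 0 := by rintro rfl; simp at hv
  have hin : inner ℝ (x (x v)) v = -inner ℝ (x v) (x v) := mem_so.1 (mem_so_iff_star.2 hs) _ _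
  have hxx : x (x v) = c • v := by
    have := congrArg (fun T : Module.End ℝ V => T v) hc
    simpa using this
  rw [hxx, real_inner_smul_left, real_inner_self_eq_norm_sq, real_inner_self_eq_norm_sq] at hin
  have h1 : 0 < ‖v‖ ^ 2 := by positivity
  have h2 : 0 < ‖x v‖ ^ 2 := by positivity
  have hneg : 0 < -c := by
    by_contra! h
    nlinarith
  refine ⟨(√(-c))⁻¹, ?_⟩
  rw [smul_mul_smul_comm, hc, smul_smul, ← mul_inv, Real.mul_self_sqrt hneg.le]
  rw [show (-c)⁻¹ * c = -1 by rw [inv_neg, neg_mul, inv_mul_cancel₀ (by linarith)]]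
  simp

omit [Nontrivial V] in
theorem exists_mul_add_mul_eq {x y : Module.End ℝ V} (hx : x ∈ D) (hy : y ∈ D)
    (hsx : star x = -x) (hsy : star y = -y) : ∃ c : ℝ, x * y + y * x = c • 1 :=
  hD.eq_smul_one _ (add_mem (mul_mem hx hy) (mul_mem hy hx)) (by
    rw [star_add, star_mul, star_mul, hsx, hsy, neg_mul_neg, neg_mul_neg, add_comm])

omit [Nontrivial V] in
/-- A skew part of dimension at least two is spanned by `I`, `J` and `I * J` for an anticommuting
pair `I`, `J` of square roots of `-1`. -/
theorem exists_quaternion_basis (h2 : 2 ≤ Module.finrank ℝ (skewPart D)) :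
    ∃ I ∈ D, ∃ J ∈ D, star I = -I ∧ star J = -J ∧ I * I = -1 ∧ J * J = -1 ∧ J * I = -(I * J) ∧
      ∀ x ∈ D, star x = -x → ∃ a b c : ℝ, x = a • I + b • J + c • (I * J) := by
  have hpos : 0 < Module.finrank ℝ (skewPart D) := by omega
  have : Nontrivial (skewPart D) := Module.nontrivial_of_finrank_pos hpos
  obtain ⟨z, hz⟩ := exists_ne (0 : skewPart D)
  have hz0 : ((z : so V) : Module.End ℝ V) ≠ 0 := fun h => hz (Subtype.ext (Subtype.ext h))
  have hzs := mem_so_iff_star.1 (z : so V).2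
  have hzD : ((z : so V) : Module.End ℝ V) ∈ D := z.2
  obtain ⟨t, hI⟩ := hD.exists_smul_sq_eq_neg_one hzD hzs hz0
  obtain ⟨y, hy⟩ : ∃ y : skewPart D, ∀ c : ℝ, c • z ≠ y := by
    by_contra! h
    have := finrank_le_one z h
    omega
  obtain ⟨I, hIdef⟩ : ∃ I, I = t • ((z : so V) : Module.End ℝ V) := ⟨_, rfl⟩
  rw [← hIdef] at hI
  have hID : I ∈ D := hIdef ▸ D.smul_mem hzD t
  have hIs : star I = -I := by rw [hIdef, star_smul_end, hzs, smul_neg]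
  have hys := mem_so_iff_star.1 (y : so V).2
  have hyD : ((y : so V) : Module.End ℝ V) ∈ D := y.2
  set Y : Module.End ℝ V := ((y : so V) : Module.End ℝ V)
  obtain ⟨c, hc⟩ := hD.exists_mul_add_mul_eq hID hyD hIs hys
  -- Anticommutators of skew elements are scalars: this is the part of `Y` orthogonal to `I`.
  have hwD : Y + (c / 2) • I ∈ D := add_mem hyD (D.smul_mem hID _)
  have hws : star (Y + (c / 2) • I) = -(Y + (c / 2) • I) := by
    rw [star_add, star_smul_end, hIs, hys]; module
  have hw0 : Y + (c / 2) • I ≠ 0 := by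
    intro h
    refine hy (-(c / 2) * t) (Subtype.ext (Subtype.ext ?_))
    change (-(c / 2) * t) • ((z : so V) : Module.End ℝ V) = Y
    rw [mul_smul, ← hIdef]
    linear_combination (norm := module) -h
  obtain ⟨s, hJ⟩ := hD.exists_smul_sq_eq_neg_one hwD hws hw0
  have hanti : (Y + (c / 2) • I) * I = -(I * (Y + (c / 2) • I)) := by
    rw [add_mul, mul_add, smul_mul_assoc, mul_smul_comm, hI]
    linear_combination (norm := module) hc
  obtain ⟨J, hJdef⟩ : ∃ J, J = s • (Y + (c / 2) • I) := ⟨_, rfl⟩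
  rw [← hJdef] at hJ
  have hJD : J ∈ D := hJdef ▸ D.smul_mem hwD s
  have hJs : star J = -J := by rw [hJdef, star_smul_end, hws, smul_neg]
  have hJI : J * I = -(I * J) := by
    rw [hJdef, smul_mul_assoc, hanti, mul_smul_comm, smul_neg]
  have hKs : star (I * J) = -(I * J) := by rw [star_mul, hJs, hIs, neg_mul_neg, hJI]
  have hKD : I * J ∈ D := mul_mem hID hJD
  have hKK : I * J * (I * J) = -1 := by
    calc I * J * (I * J) = I * (J * I) * J := by simp only [mul_assoc]
      _ = -((I * I) * (J * J)) := by rw [hJI]; simp only [mul_neg, neg_mul, mul_assoc]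
      _ = -1 := by rw [hI, hJ]; simp
  have hIK : I * (I * J) = -J := by rw [← mul_assoc, hI, neg_one_mul]
  have hKI : I * J * I = J := by rw [mul_assoc, hJI, mul_neg, hIK, neg_neg]
  have hKJ : I * J * J = -I := by rw [mul_assoc, hJ, mul_neg_one]
  have hJK : J * (I * J) = I := by rw [← mul_assoc, hJI, neg_mul, hKJ, neg_neg]
  refine ⟨I, hID, J, hJD, hIs, hJs, hI, hJ, hJI, fun x hx hxs => ?_⟩
  obtain ⟨a, ha⟩ := hD.exists_mul_add_mul_eq hID hx hIs hxs
  obtain ⟨b, hb⟩ := hD.exists_mul_add_mul_eq hJD hx hJs hxs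
  obtain ⟨d, hd⟩ := hD.exists_mul_add_mul_eq hKD hx hKs hxs
  -- The part `w` of `x` orthogonal to `I`, `J`, `I * J` anticommutes with all three; but as it
  -- anticommutes with `I` and `J`, it commutes with `I * J`. So `I * J * w = 0`.
  obtain ⟨w, hwdef⟩ : ∃ w, w = x + (a / 2) • I + (b / 2) • J + (d / 2) • (I * J) := ⟨_, rfl⟩
  have hwI : I * w = -(w * I) := by
    simp only [hwdef, mul_add, add_mul, smul_mul_assoc, mul_smul_comm, hI, hIK, hKI, hJI]
    linear_combination (norm := module) ha
  have hwJ : J * w = -(w * J) := by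
    simp only [hwdef, mul_add, add_mul, smul_mul_assoc, mul_smul_comm, hJ, hKJ, hJK, hJI]
    linear_combination (norm := module) hb
  have hwK : I * J * w = -(w * (I * J)) := by
    simp only [hwdef, mul_add, add_mul, smul_mul_assoc, mul_smul_comm, hKK, hKI, hIK, hKJ, hJK]
    linear_combination (norm := module) hd
  have hwK' : I * J * w = w * (I * J) := by
    rw [mul_assoc, hwJ, mul_neg, ← mul_assoc, hwI, neg_mul, neg_neg, mul_assoc]
  have h0 : I * J * w = 0 := by
    linear_combination (norm := module) (1 / 2 : ℝ) • (hwK + hwK')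
  have hw : w = 0 := by
    have : -w = 0 := by rw [← neg_one_mul, ← hKK, mul_assoc, h0, mul_zero]
    simpa using this
  refine ⟨-(a / 2), -(b / 2), -(d / 2), ?_⟩
  linear_combination (norm := module) hwdef.symm.trans hw

theorem nonempty_equiv_sp (h2 : 2 ≤ Module.finrank ℝ (skewPart D)) :
    Nonempty (skewPart D ≃ₗ⁅ℝ⁆ sp 1) := by
  obtain ⟨I, hID, J, hJD, hIs, hJs, hI, hJ, hJI, hspan⟩ := hD.exists_quaternion_basis h2
  let q : QuaternionAlgebra.Basis (Module.End ℝ V) (-1 : ℝ) 0 (-1) :=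
    { i := I, j := J, k := I * J
      i_mul_i := by rw [hI]; simp
      j_mul_j := by rw [hJ]; simp
      i_mul_j := rfl
      j_mul_i := by rw [hJI]; simp }
  let φ : ℍ[ℝ] →ₐ[ℝ] Module.End ℝ V := q.liftHom
  have hφ : ∀ a : ℍ[ℝ], φ a = algebraMap ℝ _ a.re + a.imI • I + a.imJ • J + a.imK • (I * J) :=
    fun _ => rfl
  have hKs : star (I * J) = -(I * J) := by rw [star_mul, hJs, hIs, neg_mul_neg, hJI]
  have hre : ∀ A : sp 1, ((A : Matrix (Fin 1) (Fin 1) ℍ[ℝ]) 0 0).re = 0 := by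
    rintro ⟨A, hA⟩
    have h := congrArg (fun M : Matrix (Fin 1) (Fin 1) ℍ[ℝ] => (M 0 0).re)
      (show A.conjTranspose = -A from hA)
    simp at h
    change (A 0 0).re = 0
    linarith
  have hpure : ∀ a : ℍ[ℝ], a.re = 0 → φ a ∈ so V ∧ φ a ∈ D := by
    intro a ha
    rw [hφ, ha, map_zero, zero_add]
    refine ⟨?_, add_mem (add_mem (D.smul_mem hID _) (D.smul_mem hJD _))
      (D.smul_mem (mul_mem hID hJD) _)⟩
    rw [mem_so_iff_star]
    simp only [star_add, star_smul_end, hIs, hJs, hKs]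
    module
  let F : sp 1 →ₗ⁅ℝ⁆ skewPart D :=
    { toFun := fun A => ⟨⟨φ ((A : Matrix (Fin 1) (Fin 1) ℍ[ℝ]) 0 0), (hpure _ (hre A)).1⟩,
        (hpure _ (hre A)).2⟩
      map_add' := fun A B => Subtype.ext (Subtype.ext (map_add φ _ _))
      map_smul' := fun c A => Subtype.ext (Subtype.ext (map_smul φ.toLinearMap c _))
      map_lie' := by
        intro A B
        apply Subtype.ext
        apply Subtype.ext
        have h1 : ∀ M N : Matrix (Fin 1) (Fin 1) ℍ[ℝ], (M * N - N * M) 0 0 =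
            M 0 0 * N 0 0 - N 0 0 * M 0 0 := by
          intro M N
          simp [Matrix.mul_apply]
        refine (congrArg φ (h1 _ _)).trans ?_
        rw [map_sub, map_mul, map_mul]
        rfl }
  refine ⟨(LieEquiv.ofBijective F ⟨?_, ?_⟩).symm⟩
  · rw [injective_iff_map_eq_zero]
    intro A hA
    have h1 : φ ((A : Matrix (Fin 1) (Fin 1) ℍ[ℝ]) 0 0) = 0 :=
      congrArg (fun x : skewPart D => ((x : so V) : Module.End ℝ V)) hA
    have h2 := (map_eq_zero φ).1 h1
    apply Subtype.ext
    ext1 i j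
    rw [Subsingleton.elim i 0, Subsingleton.elim j 0]
    exact h2
  · rintro ⟨⟨x, hx⟩, hxD⟩
    obtain ⟨a, b, c, habc⟩ := hspan x hxD (mem_so_iff_star.1 hx)
    obtain ⟨p, hp, hpa, hpb, hpc⟩ : ∃ p : ℍ[ℝ], p.re = 0 ∧ p.imI = a ∧ p.imJ = b ∧ p.imK = c :=
      ⟨⟨0, a, b, c⟩, rfl, rfl, rfl, rfl⟩
    refine ⟨⟨Matrix.of fun _ _ => p, ?_⟩, Subtype.ext (Subtype.ext ?_)⟩
    · change Matrix.conjTranspose _ = _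
      ext1 i j
      exact Quaternion.star_eq_neg.2 hp
    · change φ p = x
      rw [hφ, habc, hp, hpa, hpb, hpc, map_zero, zero_add]

end HasScalarSymmetricPart

theorem finrank_u_one : Module.finrank ℝ (u 1) = 1 := by
  refine finrank_eq_one_iff'.2 ⟨⟨Matrix.of fun _ _ => Complex.I, ?_⟩, ?_, ?_⟩
  · change Matrix.conjTranspose _ = _
    ext1 i j
    simp
  · intro h
    have := congrArg (fun A : u 1 => (A : Matrix (Fin 1) (Fin 1) ℂ) 0 0) h
    exact Complex.I_ne_zero this
  · rintro ⟨A, hA⟩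
    have h := congrArg (fun M : Matrix (Fin 1) (Fin 1) ℂ => (M 0 0).re)
      (show A.conjTranspose = -A from hA)
    have hre : (A 0 0).re = 0 := by
      simp at h
      linarith
    refine ⟨(A 0 0).im, Subtype.ext ?_⟩
    ext1 i j
    rw [Subsingleton.elim i 0, Subsingleton.elim j 0]
    change (A 0 0).im • Complex.I = A 0 0
    apply Complex.ext <;> simp [hre]

theorem nonempty_lieEquiv_of_finrank_eq_one {L M : Type*} [LieRing L] [LieAlgebra ℝ L] [LieRing M]
    [LieAlgebra ℝ M] (hL : Module.finrank ℝ L = 1) (hM : Module.finrank ℝ M = 1) :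
    Nonempty (L ≃ₗ⁅ℝ⁆ M) := by
  have hlie : ∀ x y : L, ⁅x, y⁆ = 0 := by
    intro x y
    obtain ⟨v, -, hv⟩ := finrank_eq_one_iff'.1 hL
    obtain ⟨a, rfl⟩ := hv x
    obtain ⟨b, rfl⟩ := hv y
    simp
  have hfL := Module.finite_of_finrank_pos (R := ℝ) (M := L) (by omega)
  have hfM := Module.finite_of_finrank_pos (R := ℝ) (M := M) (by omega)
  have e : L ≃ₗ[ℝ] M := LinearEquiv.ofFinrankEq L M (hL.trans hM.symm)
  refine ⟨{ e with map_lie' := ?_ }⟩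
  intro x y
  obtain ⟨v, -, hv⟩ := finrank_eq_one_iff'.1 hM
  change e ⁅x, y⁆ = ⁅e x, e y⁆
  obtain ⟨a, ha⟩ := hv (e x)
  obtain ⟨b, hb⟩ := hv (e y)
  rw [hlie, map_zero, ← ha, ← hb]
  simp

end StarSubalgebra

/-! ### Bivectors -/

section Bivectors

variable {r : ℕ}

theorem e_mul_self (i : Fin r) : e r i * e r i = -1 := by
  have h : (2 : ℝ) • (e r i * e r i + 1) = 0 := by
    have := e_mul_e_add r i i
    rw [if_pos rfl, Algebra.algebraMap_eq_smul_one] at this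
    linear_combination (norm := module) this
  exact eq_neg_of_add_eq_zero_left ((smul_eq_zero.1 h).resolve_left two_ne_zero)

theorem e_mul_e_of_ne {i j : Fin r} (h : i ≠ j) : e r i * e r j = -(e r j * e r i) := by
  have := e_mul_e_add r i j
  rw [if_neg h, map_zero] at this
  exact eq_neg_of_add_eq_zero_left this

theorem bivector_self (i : Fin r) : bivector r i i = -1 := Subtype.ext (e_mul_self i)

theorem bivector_swap {i j : Fin r} (h : i ≠ j) : bivector r i j = -bivector r j i :=
  Subtype.ext (e_mul_e_of_ne h)

theorem bivector_mul_bivector {i j l : Fin r} (h : j ≠ l) :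
    bivector r i l * bivector r j l = bivector r i j := by
  apply Subtype.ext
  change e r i * e r l * (e r j * e r l) = e r i * e r j
  rw [e_mul_e_of_ne h, mul_neg, mul_assoc, ← mul_assoc (e r l), e_mul_self]
  simp

theorem bivector_mul_self {i j : Fin r} (h : i ≠ j) : bivector r i j * bivector r i j = -1 := by
  rw [bivector_mul_bivector h, bivector_self]

theorem bilin_mem_of_bivector_mem {S : Subalgebra ℝ (ClEven r)}
    (hS : ∀ i j : Fin r, i < j → bivector r i j ∈ S) (x y : Fin r → ℝ) :
    (CliffordAlgebra.even.ι (Q r)).bilin x y ∈ S := by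
  have hb : ∀ i j : Fin r, bivector r i j ∈ S := by
    intro i j
    rcases lt_trichotomy i j with h | rfl | h
    · exact hS i j h
    · rw [bivector_self]; exact neg_mem (one_mem S)
    · rw [bivector_swap h.ne']; exact neg_mem (hS j i h)
  rw [pi_eq_sum_univ' x, pi_eq_sum_univ' y, map_sum]
  refine sum_mem fun j _ => ?_
  rw [map_sum, LinearMap.sum_apply]
  refine sum_mem fun i _ => ?_
  rw [map_smul, map_smul, LinearMap.smul_apply]
  exact S.smul_mem (S.smul_mem (hb i j) _) _

/-- The bivectors generate `Cl_r⁰`. -/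
theorem subalgebra_eq_top_of_bivector_mem {S : Subalgebra ℝ (ClEven r)}
    (hS : ∀ i j : Fin r, i < j → bivector r i j ∈ S) : S = ⊤ := by
  rw [eq_top_iff]
  rintro ⟨x, hx⟩ -
  induction x, hx using CliffordAlgebra.even_induction with
  | algebraMap c => exact S.algebraMap_mem c
  | add x y hx hy ihx ihy => exact S.add_mem ihx ihy
  | ι_mul_ι_mul m₁ m₂ x hx ih => exact S.mul_mem (bilin_mem_of_bivector_mem hS m₁ m₂) ih

theorem e_mem_pinGroup (i : Fin r) : e r i ∈ pinGroup (Q r) := by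
  have hs : star (e r i) = -e r i := CliffordAlgebra.star_ι _
  refine pinGroup.mem_iff.2 ⟨?_, ?_, ?_⟩
  · refine ⟨⟨e r i, -e r i, by rw [mul_neg, e_mul_self, neg_neg],
      by rw [neg_mul, e_mul_self, neg_neg]⟩, Subgroup.subset_closure ⟨_, rfl⟩, rfl⟩
  · rw [hs, neg_mul, e_mul_self, neg_neg]
  · rw [hs, mul_neg, e_mul_self, neg_neg]

/-- The bivector `eᵢ eⱼ`, as an element of the group `Spin(r)`; for `i = j` this is `-1`. -/
def spinBivector (i j : Fin r) : Spin r :=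
  ⟨e r i * e r j, mul_mem (e_mem_pinGroup i) (e_mem_pinGroup j), (bivector r i j).2⟩

end Bivectors

/-! ### The commutant of an irreducible representation -/

namespace EuclideanRep

variable {r : ℕ} {V W : Type*} [NormedAddCommGroup V] [InnerProductSpace ℝ V]
  [NormedAddCommGroup W] [InnerProductSpace ℝ W]

/-- The commutant of the image of `Cl_r⁰` in `End V`. -/
def commutant (ρ : EuclideanRep r V) : Subalgebra ℝ (Module.End ℝ V) :=
  Subalgebra.centralizer ℝ (Set.range ρ.toAlgHom)

theorem mem_commutant {ρ : EuclideanRep r V} {A : Module.End ℝ V} :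
    A ∈ ρ.commutant ↔ ∀ a, ρ.toAlgHom a * A = A * ρ.toAlgHom a := by
  rw [commutant, Subalgebra.mem_centralizer_iff, Set.forall_mem_range]

theorem intertwines_of_bivector {ρ : EuclideanRep r V} {τ : EuclideanRep r W} {f : V →ₗ[ℝ] W}
    (h : ∀ i j : Fin r, i < j →
      f ∘ₗ ρ.toAlgHom (bivector r i j) = τ.toAlgHom (bivector r i j) ∘ₗ f) (a : ClEven r) :
    f ∘ₗ ρ.toAlgHom a = τ.toAlgHom a ∘ₗ f := by
  let S : Subalgebra ℝ (ClEven r) :=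
    { carrier := {a | f ∘ₗ ρ.toAlgHom a = τ.toAlgHom a ∘ₗ f}
      mul_mem' := by
        intro a b ha hb
        simp only [Set.mem_ofPred_eq] at *
        rw [map_mul, map_mul, Module.End.mul_eq_comp, Module.End.mul_eq_comp,
          ← LinearMap.comp_assoc, ha, LinearMap.comp_assoc, hb, LinearMap.comp_assoc]
      add_mem' := by
        intro a b ha hb
        simp only [Set.mem_ofPred_eq] at *
        rw [map_add, map_add, LinearMap.comp_add, ha, hb, LinearMap.add_comp]
      algebraMap_mem' := by
        intro c
        simp only [Set.mem_ofPred_eq, Algebra.algebraMap_eq_smul_one]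
        ext v
        simp }
  have hS : S = ⊤ := subalgebra_eq_top_of_bivector_mem h
  exact (hS ▸ Algebra.mem_top : a ∈ S)

theorem mem_commutant_of_bivector {ρ : EuclideanRep r V} {A : Module.End ℝ V}
    (h : ∀ i j : Fin r, i < j →
      A * ρ.toAlgHom (bivector r i j) = ρ.toAlgHom (bivector r i j) * A) : A ∈ ρ.commutant :=
  mem_commutant.2 fun a => (intertwines_of_bivector (τ := ρ) h a).symm

variable [FiniteDimensional ℝ V] [FiniteDimensional ℝ W]

theorem star_bivector (ρ : EuclideanRep r V) {i j : Fin r} (h : i < j) :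
    star (ρ.toAlgHom (bivector r i j)) = -ρ.toAlgHom (bivector r i j) :=
  mem_so_iff_star.1 (ρ.skew i j h)

theorem star_mem_commutant {ρ : EuclideanRep r V} {A : Module.End ℝ V} (hA : A ∈ ρ.commutant) :
    star A ∈ ρ.commutant := by
  refine mem_commutant_of_bivector fun i j hij => ?_
  have h := congrArg star (mem_commutant.1 hA (bivector r i j))
  rw [star_mul, star_mul, ρ.star_bivector hij, mul_neg, neg_mul] at h
  exact neg_injective h

/-- A symmetric endomorphism has a real eigenvalue, and its eigenspaces are invariant under
everything that commutes with it. -/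
theorem IsIrreducible.eq_smul_one {ρ : EuclideanRep r V} (hρ : ρ.IsIrreducible)
    {A : Module.End ℝ V} (hA : A ∈ ρ.commutant) (hs : star A = A) : ∃ c : ℝ, A = c • 1 := by
  have := hρ.1
  have hev := (isSymmetric_iff_star.2 hs).hasEigenvalue_iSup_of_finiteDimensional
  set c : ℝ := _ with hc
  change Module.End.HasEigenvalue A c at hev
  clear_value c
  rcases hρ.2 (Module.End.eigenspace A c) fun a v hv => by
      rw [Module.End.mem_eigenspace_iff] at hv ⊢
      have := congrArg (fun T : Module.End ℝ V => T v) (mem_commutant.1 hA a)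
      change ρ.toAlgHom a (A v) = A (ρ.toAlgHom a v) at this
      rw [← this, hv, map_smul] with h | h
  · exact absurd h hev
  · refine ⟨c, LinearMap.ext fun v => ?_⟩
    have hv : v ∈ Module.End.eigenspace A c := h ▸ Submodule.mem_top
    exact Module.End.mem_eigenspace_iff.1 hv

theorem IsIrreducible.hasScalarSymmetricPart {ρ : EuclideanRep r V} (hρ : ρ.IsIrreducible) :
    HasScalarSymmetricPart ρ.commutant :=
  ⟨fun _ => star_mem_commutant, fun _ => hρ.eq_smul_one⟩

omit [FiniteDimensional ℝ V] in
theorem mem_spinCentralizer_iff {ρ : EuclideanRep r V} {x : so V} :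
    x ∈ ρ.spinCentralizer ↔ ∀ y : spin r, ⁅x, ρ.spinToSo y⁆ = 0 := by
  refine ⟨fun h y => h _ ⟨y, rfl⟩, ?_⟩
  rintro h _ ⟨y, rfl⟩
  exact h y

omit [FiniteDimensional ℝ V] in
theorem spinCentralizer_eq_skewPart (ρ : EuclideanRep r V) :
    ρ.spinCentralizer = skewPart ρ.commutant := by
  have hlie : ∀ (x : so V) (y : spin r), ⁅x, ρ.spinToSo y⁆ = 0 ↔
      (x : Module.End ℝ V) * ρ.toAlgHom y = ρ.toAlgHom y * x := fun x y => by
    rw [← sub_eq_zero (b := ρ.toAlgHom y * (x : Module.End ℝ V)), Subtype.ext_iff]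
    rfl
  ext x
  rw [mem_spinCentralizer_iff, mem_skewPart]
  constructor
  · intro h
    refine mem_commutant_of_bivector fun i j hij => ?_
    exact (hlie x ⟨bivector r i j, Submodule.subset_span ⟨i, j, hij, rfl⟩⟩).1 (h _)
  · intro h y
    exact (hlie x y).2 (mem_commutant.1 h y).symm

section Family

variable {n : ℕ}

/-- The images of the bivectors `eᵢ eᵣ`, `i < r`, of `Cl_r⁰` for `r = n + 1`, continued by zero to a
family indexed by `ℕ`. They generate the image of `Cl_r⁰`. -/
noncomputable def cliffordFamily (ρ : EuclideanRep (n + 1) V) (i : ℕ) : Module.End ℝ V :=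
  if h : i < n then ρ.toAlgHom (bivector (n + 1) (Fin.castSucc ⟨i, h⟩) (Fin.last n)) else 0

omit [FiniteDimensional ℝ V] in
theorem cliffordFamily_of_lt (ρ : EuclideanRep (n + 1) V) {i : ℕ} (h : i < n) :
    ρ.cliffordFamily i = ρ.toAlgHom (bivector (n + 1) (Fin.castSucc ⟨i, h⟩) (Fin.last n)) :=
  dif_pos h

theorem isCliffordFamily (ρ : EuclideanRep (n + 1) V) : IsCliffordFamily n ρ.cliffordFamily where
  sq i hi := by
    rw [cliffordFamily_of_lt _ hi, ← map_mul, bivector_mul_self (Fin.castSucc_lt_last _).ne,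
      map_neg, map_one]
  anticomm i hi j hj hij := by
    rw [cliffordFamily_of_lt _ hi, cliffordFamily_of_lt _ hj, ← map_mul, ← map_mul,
      bivector_mul_bivector (Fin.castSucc_lt_last _).ne,
      bivector_mul_bivector (Fin.castSucc_lt_last _).ne, ← map_neg, bivector_swap]
    simpa using hij
  skew i hi := by
    rw [cliffordFamily_of_lt _ hi, ρ.star_bivector (Fin.castSucc_lt_last _)]

omit [FiniteDimensional ℝ V] in
theorem mem_commutant_iff_cliffordFamily {ρ : EuclideanRep (n + 1) V} {A : Module.End ℝ V} :
    A ∈ ρ.commutant ↔ ∀ i < n, A * ρ.cliffordFamily i = ρ.cliffordFamily i * A := by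
  constructor
  · intro hA i hi
    rw [cliffordFamily_of_lt _ hi, mem_commutant.1 hA]
  · intro hA
    have hlast : ∀ i : Fin (n + 1), i ≠ Fin.last n →
        A * ρ.toAlgHom (bivector _ i (Fin.last n)) =
          ρ.toAlgHom (bivector _ i (Fin.last n)) * A := by
      intro i hi
      obtain ⟨i, rfl⟩ := Fin.exists_castSucc_eq.2 hi
      have := hA i i.2
      rwa [cliffordFamily_of_lt _ i.2] at this
    refine mem_commutant_of_bivector fun i j hij => ?_
    by_cases hj : j = Fin.last n
    · subst hj
      exact hlast i hij.ne
    · have hi : i ≠ Fin.last n := (hij.trans_le (Fin.le_last j)).ne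
      rw [← bivector_mul_bivector hj, map_mul, ← mul_assoc, hlast i hi, mul_assoc, hlast j hj,
        mul_assoc]

/-- The dimension of the centralizer of `spin(r)`, for `r = n + 1`; the first factor on the right is
the real part of `(1 + i)ʳ`. -/
theorem IsIrreducible.finrank_spinCentralizer {ρ : EuclideanRep (n + 1) V} (hρ : ρ.IsIrreducible) :
    (2 : ℝ) ^ n * (1 - Module.finrank ℝ ρ.spinCentralizer) =
      (squareSignSums n).1 * Module.finrank ℝ V := by
  have := hρ.1
  rw [spinCentralizer_eq_skewPart]
  exact hρ.hasScalarSymmetricPart.finrank_skewPart_eq ρ.isCliffordFamily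
    fun _ => mem_commutant_iff_cliffordFamily

end Family

/-- The index `(r + 7) % 8` stands for `(r - 1) % 8`, without truncated subtraction. -/
theorem IsIrreducible.sign_finrank_spinCentralizer {ρ : EuclideanRep r V} (hρ : ρ.IsIrreducible)
    (hr : 1 ≤ r) : SignType.sign (1 - Module.finrank ℝ ρ.spinCentralizer : ℝ) =
      SignType.sign (squareSignSums ((r + 7) % 8)).1 := by
  obtain ⟨n, rfl⟩ := Nat.exists_eq_add_of_le' hr
  have := hρ.1
  have h := congrArg SignType.sign hρ.finrank_spinCentralizer
  have hV : (0 : ℝ) < Module.finrank ℝ V := by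
    exact_mod_cast Module.finrank_pos (R := ℝ) (M := V)
  rw [sign_mul, sign_mul, sign_pos hV, sign_pos (by positivity : (0 : ℝ) < 2 ^ n), one_mul,
    mul_one] at h
  rw [h, show (n + 1 + 7) % 8 = n % 8 by omega, ← sign_squareSignSums]
  rcases lt_trichotomy (squareSignSums n).1 0 with h | h | h
  · rw [sign_neg h, sign_neg (by exact_mod_cast h)]
  · rw [h]; simp
  · rw [sign_pos h, sign_pos (by exact_mod_cast h)]

theorem IsIrreducible.spinCentralizer_eq_bot {ρ : EuclideanRep r V} (hρ : ρ.IsIrreducible)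
    (hr : 1 ≤ r) (h : r % 8 = 0 ∨ r % 8 = 1 ∨ r % 8 = 7) : ρ.spinCentralizer = ⊥ := by
  have hs := hρ.sign_finrank_spinCentralizer hr
  have h1 : SignType.sign (squareSignSums ((r + 7) % 8)).1 = 1 := by
    rcases (by omega : (r + 7) % 8 = 7 ∨ (r + 7) % 8 = 0 ∨ (r + 7) % 8 = 6) with h | h | h <;>
      rw [h] <;> decide
  rw [h1, sign_eq_one_iff, sub_pos] at hs
  have h0 : Module.finrank ℝ ρ.spinCentralizer = 0 := by
    have : Module.finrank ℝ ρ.spinCentralizer < 1 := by exact_mod_cast hs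
    omega
  rw [← LieSubalgebra.toSubmodule_eq_bot]
  exact Submodule.finrank_eq_zero.1 h0

theorem IsIrreducible.nonempty_spinCentralizer_equiv_u {ρ : EuclideanRep r V}
    (hρ : ρ.IsIrreducible) (hr : 1 ≤ r) (h : r % 8 = 2 ∨ r % 8 = 6) :
    Nonempty (ρ.spinCentralizer ≃ₗ⁅ℝ⁆ u 1) := by
  have hs := hρ.sign_finrank_spinCentralizer hr
  have h1 : SignType.sign (squareSignSums ((r + 7) % 8)).1 = 0 := by
    rcases (by omega : (r + 7) % 8 = 1 ∨ (r + 7) % 8 = 5) with h | h <;> rw [h] <;> decide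
  rw [h1, sign_eq_zero_iff, sub_eq_zero] at hs
  exact nonempty_lieEquiv_of_finrank_eq_one (by exact_mod_cast hs.symm) finrank_u_one

theorem IsIrreducible.nonempty_spinCentralizer_equiv_sp {ρ : EuclideanRep r V}
    (hρ : ρ.IsIrreducible) (hr : 1 ≤ r) (h : r % 8 = 3 ∨ r % 8 = 4 ∨ r % 8 = 5) :
    Nonempty (ρ.spinCentralizer ≃ₗ⁅ℝ⁆ sp 1) := by
  have hs := hρ.sign_finrank_spinCentralizer hr
  have h1 : SignType.sign (squareSignSums ((r + 7) % 8)).1 = -1 := by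
    rcases (by omega : (r + 7) % 8 = 2 ∨ (r + 7) % 8 = 3 ∨ (r + 7) % 8 = 4) with h | h | h <;>
      rw [h] <;> decide
  rw [h1, sign_eq_neg_one_iff, sub_neg] at hs
  have h2 : 1 < Module.finrank ℝ ρ.spinCentralizer := by exact_mod_cast hs
  have := hρ.1
  rw [spinCentralizer_eq_skewPart] at h2 ⊢
  exact hρ.hasScalarSymmetricPart.nonempty_equiv_sp h2

end EuclideanRep

/-! ### Invariants of the group `Spin(r)` -/

namespace EuclideanRep

variable {r : ℕ} {V W : Type*} [NormedAddCommGroup V] [InnerProductSpace ℝ V]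
  [NormedAddCommGroup W] [InnerProductSpace ℝ W] [FiniteDimensional ℝ V] [FiniteDimensional ℝ W]

/-- The anti-involution `star` of `Cl_r`, which is the inversion on `Spin(r)`, preserves `Cl_r⁰` and
acts there by adjoints. -/
theorem exists_toAlgHom_star (ρ : EuclideanRep r V) (a : ClEven r) :
    ∃ h : star (a : Cl r) ∈ CliffordAlgebra.even (Q r),
      ρ.toAlgHom ⟨star (a : Cl r), h⟩ = star (ρ.toAlgHom a) := by
  let S : Subalgebra ℝ (ClEven r) :=
    { carrier := {a | ∃ h : star (a : Cl r) ∈ CliffordAlgebra.even (Q r),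
        ρ.toAlgHom ⟨star (a : Cl r), h⟩ = star (ρ.toAlgHom a)}
      mul_mem' := by
        rintro a b ⟨ha, ha'⟩ ⟨hb, hb'⟩
        have hab : star ((a * b : ClEven r) : Cl r) = star (b : Cl r) * star (a : Cl r) :=
          star_mul (a : Cl r) b
        refine ⟨hab ▸ mul_mem hb ha, ?_⟩
        rw [map_mul, star_mul, ← ha', ← hb', ← map_mul]
        exact congrArg _ (Subtype.ext hab)
      add_mem' := by
        rintro a b ⟨ha, ha'⟩ ⟨hb, hb'⟩
        have hab : star ((a + b : ClEven r) : Cl r) = star (a : Cl r) + star (b : Cl r) :=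
          star_add (a : Cl r) b
        refine ⟨hab ▸ add_mem ha hb, ?_⟩
        rw [map_add, star_add, ← ha', ← hb', ← map_add]
        exact congrArg _ (Subtype.ext hab)
      algebraMap_mem' := by
        intro c
        have hc : star ((algebraMap ℝ (ClEven r) c : ClEven r) : Cl r) = algebraMap ℝ (Cl r) c :=
          CliffordAlgebra.star_algebraMap c
        refine ⟨hc ▸ Subalgebra.algebraMap_mem _ c, ?_⟩
        have hc' : star (ρ.toAlgHom (algebraMap ℝ (ClEven r) c)) =
            ρ.toAlgHom (algebraMap ℝ (ClEven r) c) := by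
          rw [AlgHom.commutes, Algebra.algebraMap_eq_smul_one, star_smul_end, star_one]
        rw [hc']
        exact congrArg _ (Subtype.ext hc) }
  have hS : S = ⊤ := by
    refine subalgebra_eq_top_of_bivector_mem fun i j hij => ?_
    have hb : star (bivector r i j : Cl r) = ((-bivector r i j : ClEven r) : Cl r) := by
      change star (e r i * e r j) = -(e r i * e r j)
      have hs : ∀ i, star (e r i) = -e r i := fun i => CliffordAlgebra.star_ι _
      rw [star_mul, hs, hs, neg_mul_neg, e_mul_e_of_ne hij.ne, neg_neg]
    refine ⟨hb ▸ (-bivector r i j).2, ?_⟩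
    rw [ρ.star_bivector hij, ← map_neg]
    exact congrArg _ (Subtype.ext hb)
  exact (hS ▸ Algebra.mem_top : a ∈ S)

theorem spinRep_mul_star (ρ : EuclideanRep r V) (g : Spin r) :
    ρ.spinRep g * star (ρ.spinRep g) = 1 := by
  obtain ⟨h, hs⟩ := ρ.exists_toAlgHom_star ⟨g, spinGroup.mem_even g.2⟩
  change ρ.toAlgHom ⟨g, spinGroup.mem_even g.2⟩ * star (ρ.toAlgHom ⟨g, spinGroup.mem_even g.2⟩) = 1
  rw [← hs, ← map_mul, ← map_one ρ.toAlgHom]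
  exact congrArg _ (Subtype.ext (spinGroup.mul_star_self_of_mem g.2))

theorem spinRep_star_mul (ρ : EuclideanRep r V) (g : Spin r) :
    star (ρ.spinRep g) * ρ.spinRep g = 1 :=
  mul_eq_one_comm.1 (ρ.spinRep_mul_star g)

omit [FiniteDimensional ℝ V] in
theorem mem_commutant_iff_spinRep {ρ : EuclideanRep r V} {A : Module.End ℝ V} :
    A ∈ ρ.commutant ↔ ∀ g : Spin r, ρ.spinRep g * A = A * ρ.spinRep g :=
  ⟨fun hA _ => mem_commutant.1 hA _, fun h =>
    mem_commutant_of_bivector fun i j _ => (h (spinBivector i j)).symm⟩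

/-- Under `Λ² V ≅ so(V)` the action `Λ² g` becomes `A ↦ g A g*`. -/
theorem wedgeToSo_map (g : Module.End ℝ V) (t : ⋀[ℝ]^2 V) :
    (wedgeToSo (exteriorPower.map 2 g t) : Module.End ℝ V) =
      g * (wedgeToSo t : Module.End ℝ V) * star g := by
  suffices h : (so V).toSubmodule.subtype ∘ₗ wedgeToSo ∘ₗ exteriorPower.map 2 g =
      sandwich g (star g) ∘ₗ (so V).toSubmodule.subtype ∘ₗ wedgeToSo by
    have := LinearMap.congr_fun h t
    rw [mul_assoc]
    exact this
  apply exteriorPower.linearMap_ext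
  ext v x
  change ((wedgeToSo (exteriorPower.map 2 g (exteriorPower.ιMulti ℝ 2 v)) : so V) :
    Module.End ℝ V) x = g (((wedgeToSo (exteriorPower.ιMulti ℝ 2 v) : so V) :
      Module.End ℝ V) (star g x))
  rw [exteriorPower.map_apply_ιMulti, wedgeToSo_ιMulti, wedgeToSo_ιMulti, wedgeEnd_apply,
    wedgeEnd_apply, map_sub, map_smul, map_smul, LinearMap.star_eq_adjoint,
    LinearMap.adjoint_inner_right, LinearMap.adjoint_inner_right]
  rfl

/-- The invariants of `Λ² V` are the centralizer of `spin(r)` in `so(V)`, for any representation. -/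
theorem map_extSqInvariants (ρ : EuclideanRep r V) :
    ρ.extSqInvariants.map (wedgeEquivSo V).toLinearMap = ρ.spinCentralizer.toSubmodule := by
  have key : ∀ t : ⋀[ℝ]^2 V, t ∈ ρ.extSqInvariants ↔ wedgeEquivSo V t ∈ ρ.spinCentralizer := by
    intro t
    rw [spinCentralizer_eq_skewPart, mem_skewPart, mem_commutant_iff_spinRep]
    refine forall_congr' fun g => ?_
    change exteriorPower.map 2 (ρ.spinRep g) t = t ↔ _
    rw [← (wedgeEquivSo V).injective.eq_iff, Subtype.ext_iff]
    have hmap := wedgeToSo_map (ρ.spinRep g) t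
    change ((wedgeEquivSo V (exteriorPower.map 2 (ρ.spinRep g) t) : so V) : Module.End ℝ V) =
      ρ.spinRep g * ((wedgeEquivSo V t : so V) : Module.End ℝ V) * star (ρ.spinRep g) at hmap
    rw [hmap]
    constructor
    · intro h
      rw [← congrArg (· * ρ.spinRep g) h]
      simp only [mul_assoc, spinRep_star_mul, mul_one]
    · intro h
      rw [h, mul_assoc, spinRep_mul_star, mul_one]
  ext x
  rw [Submodule.mem_map]
  constructor
  · rintro ⟨t, ht, rfl⟩
    exact (key t).1 ht
  · intro hx
    refine ⟨(wedgeEquivSo V).symm x, (key _).2 ?_, (wedgeEquivSo V).apply_symm_apply x⟩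
    rwa [LinearEquiv.apply_symm_apply]

theorem IsIrreducible.symZeroInvariants_eq_bot {ρ : EuclideanRep r V} (hρ : ρ.IsIrreducible) :
    ρ.symZeroInvariants = ⊥ := by
  rw [eq_bot_iff]
  rintro A ⟨⟨hsymm, htr⟩, hinv⟩
  have := hρ.1
  have hA : A ∈ ρ.commutant := by
    refine mem_commutant_iff_spinRep.2 fun g => ?_
    have h : ρ.spinRep g * (A * ρ.spinRep g⁻¹) = A := hinv g
    calc ρ.spinRep g * A = ρ.spinRep g * (A * ρ.spinRep g⁻¹) * ρ.spinRep g := by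
          rw [mul_assoc, mul_assoc, ← map_mul, inv_mul_cancel, map_one, mul_one]
      _ = A * ρ.spinRep g := by rw [h]
  obtain ⟨c, rfl⟩ := hρ.eq_smul_one hA (isSymmetric_iff_star.1 hsymm)
  rw [map_smul, LinearMap.trace_one, smul_eq_mul] at htr
  have hV : (Module.finrank ℝ V : ℝ) ≠ 0 := by
    exact_mod_cast (Module.finrank_pos (R := ℝ) (M := V)).ne'
  rw [(mul_eq_zero.1 htr).resolve_right hV, zero_smul]
  exact zero_mem _

omit [FiniteDimensional ℝ V] [FiniteDimensional ℝ W] in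
/-- Schur's lemma. -/
theorem IsIrreducible.eq_zero_of_intertwines {ρ : EuclideanRep r V} {τ : EuclideanRep r W}
    (hρ : ρ.IsIrreducible) (hτ : τ.IsIrreducible) (hne : ¬ ρ.IsIsomorphic τ) {f : V →ₗ[ℝ] W}
    (hf : ∀ a, f ∘ₗ ρ.toAlgHom a = τ.toAlgHom a ∘ₗ f) : f = 0 := by
  have hf' : ∀ a v, f (ρ.toAlgHom a v) = τ.toAlgHom a (f v) := fun a v =>
    LinearMap.congr_fun (hf a) v
  rcases hρ.2 (LinearMap.ker f) fun a v hv => by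
      rw [LinearMap.mem_ker] at hv ⊢
      rw [hf', hv, map_zero] with hker | hker
  · rcases hτ.2 (LinearMap.range f) (by
        rintro a _ ⟨v, rfl⟩
        exact ⟨_, hf' a v⟩) with hran | hran
    · exact LinearMap.range_eq_bot.1 hran
    · exact absurd ⟨LinearEquiv.ofBijective f ⟨LinearMap.ker_eq_bot.1 hker,
        LinearMap.range_eq_top.1 hran⟩, hf'⟩ hne
  · exact LinearMap.ker_eq_top.1 hker

/-- The map `V ⊗ W → Hom(V, W)`, `v ⊗ w ↦ (x ↦ ⟨v, x⟩ w)`. -/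
noncomputable def tensorToHom (V W : Type*) [NormedAddCommGroup V] [InnerProductSpace ℝ V]
    [NormedAddCommGroup W] [InnerProductSpace ℝ W] : V ⊗[ℝ] W →ₗ[ℝ] V →ₗ[ℝ] W :=
  dualTensorHom ℝ V W ∘ₗ LinearMap.rTensor W (innerₗ V)

omit [FiniteDimensional ℝ W] in
theorem tensorToHom_injective : Function.Injective (tensorToHom V W) := by
  have hinj : Function.Injective (dualTensorHom ℝ V W) := (dualTensorHom_bijective ..).1
  refine hinj.comp (Module.Flat.rTensor_preserves_injective_linearMap _ ?_)
  rw [injective_iff_map_eq_zero]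
  intro v hv
  exact inner_self_eq_zero.1 (LinearMap.congr_fun hv v)

omit [FiniteDimensional ℝ W] in
theorem tensorToHom_map (g : Module.End ℝ V) (h : Module.End ℝ W) (t : V ⊗[ℝ] W) :
    tensorToHom V W (TensorProduct.map g h t) = h ∘ₗ tensorToHom V W t ∘ₗ star g := by
  induction t with
  | zero => simp
  | add s t hs ht => rw [map_add, map_add, hs, ht, map_add, LinearMap.add_comp, LinearMap.comp_add]
  | tmul v w =>
    ext x
    change inner ℝ (g v) x • h w = h (inner ℝ v (star g x) • w)
    rw [map_smul, LinearMap.star_eq_adjoint, LinearMap.adjoint_inner_right]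

omit [FiniteDimensional ℝ W] in
theorem IsIrreducible.tensorInvariants_eq_bot {ρ : EuclideanRep r V} {τ : EuclideanRep r W}
    (hρ : ρ.IsIrreducible) (hτ : τ.IsIrreducible) (hne : ¬ ρ.IsIsomorphic τ) :
    ρ.tensorInvariants τ = ⊥ := by
  rw [eq_bot_iff]
  intro t ht
  refine tensorToHom_injective ((hρ.eq_zero_of_intertwines hτ hne
    (intertwines_of_bivector fun i j _ => ?_)).trans (map_zero _).symm)
  set g := spinBivector i j
  have h1 : TensorProduct.map (ρ.spinRep g) (τ.spinRep g) t = t := ht g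
  change tensorToHom V W t ∘ₗ ρ.spinRep g = τ.spinRep g ∘ₗ tensorToHom V W t
  conv_lhs => rw [← h1, tensorToHom_map]
  rw [LinearMap.comp_assoc, LinearMap.comp_assoc, ← Module.End.mul_eq_comp (star _),
    spinRep_star_mul]
  rfl

section Product

omit [FiniteDimensional ℝ V] [FiniteDimensional ℝ W]

theorem mem_spinCentralizer₂ {ρ : EuclideanRep r V} {τ : EuclideanRep r W} {x : so V × so W} :
    x ∈ ρ.spinCentralizer₂ τ ↔ x.1 ∈ ρ.spinCentralizer ∧ x.2 ∈ τ.spinCentralizer := by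
  rw [mem_spinCentralizer_iff, mem_spinCentralizer_iff, ← forall_and]
  constructor
  · intro h y
    exact Prod.ext_iff.1 (h (ρ.spinToSo y, τ.spinToSo y) ⟨y, rfl⟩)
  · rintro h _ ⟨y, rfl⟩
    exact Prod.ext (h y).1 (h y).2

/-- The centralizer of the diagonal `spin(r)` in `so(V) ⊕ so(W)` is the product of the centralizers
in the two factors. -/
def spinCentralizer₂EquivProd (ρ : EuclideanRep r V) (τ : EuclideanRep r W) :
    ρ.spinCentralizer₂ τ ≃ₗ⁅ℝ⁆ ρ.spinCentralizer × τ.spinCentralizer where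
  toFun x := (⟨x.1.1, (mem_spinCentralizer₂.1 x.2).1⟩, ⟨x.1.2, (mem_spinCentralizer₂.1 x.2).2⟩)
  invFun x := ⟨(x.1.1, x.2.1), mem_spinCentralizer₂.2 ⟨x.1.2, x.2.2⟩⟩
  map_add' _ _ := rfl
  map_smul' _ _ := rfl
  map_lie' := rfl
  left_inv _ := rfl
  right_inv _ := rfl

theorem nonempty_spinCentralizer₂_equiv {ρ : EuclideanRep r V} {τ : EuclideanRep r W}
    {L M : Type*} [LieRing L] [LieAlgebra ℝ L] [LieRing M] [LieAlgebra ℝ M]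
    (hρ : Nonempty (ρ.spinCentralizer ≃ₗ⁅ℝ⁆ L)) (hτ : Nonempty (τ.spinCentralizer ≃ₗ⁅ℝ⁆ M)) :
    Nonempty (ρ.spinCentralizer₂ τ ≃ₗ⁅ℝ⁆ L × M) := by
  obtain ⟨f⟩ := hρ
  obtain ⟨g⟩ := hτ
  exact ⟨(spinCentralizer₂EquivProd ρ τ).trans (LieEquiv.ofBijective
    (LieHom.prodMap f.toLieHom g.toLieHom) (f.bijective.prodMap g.bijective))⟩

end Product

end EuclideanRep

end SpinCentralizer

theorem proposition1 (r : ℕ) (hr : 1 ≤ r) :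
    -- one irreducible representation `V` of `Cl_r⁰`
    (∀ {V : Type*} [NormedAddCommGroup V] [InnerProductSpace ℝ V] [FiniteDimensional ℝ V]
      (ρ : SpinCentralizer.EuclideanRep r V), ρ.IsIrreducible →
      -- the centralizer of `spin(r)` in `so(V)`, for `r ≢ 0 (mod 4)`
      ((r % 8 = 1 ∨ r % 8 = 7) → ρ.spinCentralizer = ⊥) ∧
      ((r % 8 = 2 ∨ r % 8 = 6) →
        Nonempty (ρ.spinCentralizer ≃ₗ⁅ℝ⁆ SpinCentralizer.u 1)) ∧
      ((r % 8 = 3 ∨ r % 8 = 5) →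
        Nonempty (ρ.spinCentralizer ≃ₗ⁅ℝ⁆ SpinCentralizer.sp 1)) ∧
      -- the trivial `Spin(r)`-subrepresentations of `Λ² V`
      ((r % 8 = 0 ∨ r % 8 = 1 ∨ r % 8 = 7) → ρ.extSqInvariants = ⊥) ∧
      ((r % 8 = 2 ∨ r % 8 = 6) → ∃ L : LieSubalgebra ℝ (SpinCentralizer.so V),
        ρ.extSqInvariants.map (SpinCentralizer.wedgeEquivSo V).toLinearMap = L.toSubmodule ∧
        Nonempty (L ≃ₗ⁅ℝ⁆ SpinCentralizer.u 1)) ∧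
      ((r % 8 = 3 ∨ r % 8 = 4 ∨ r % 8 = 5) → ∃ L : LieSubalgebra ℝ (SpinCentralizer.so V),
        ρ.extSqInvariants.map (SpinCentralizer.wedgeEquivSo V).toLinearMap = L.toSubmodule ∧
        Nonempty (L ≃ₗ⁅ℝ⁆ SpinCentralizer.sp 1)) ∧
      -- the trivial `Spin(r)`-subrepresentations of `Sym₀² V`
      ρ.symZeroInvariants = ⊥) ∧
    -- for `r ≡ 0 (mod 4)`, the two irreducible representations `V`, `W` of `Cl_r⁰`
    (∀ {V W : Type*} [NormedAddCommGroup V] [InnerProductSpace ℝ V] [FiniteDimensional ℝ V]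
      [NormedAddCommGroup W] [InnerProductSpace ℝ W] [FiniteDimensional ℝ W]
      (ρ : SpinCentralizer.EuclideanRep r V) (τ : SpinCentralizer.EuclideanRep r W),
      ρ.IsIrreducible → τ.IsIrreducible → ¬ ρ.IsIsomorphic τ →
      -- the centralizer of `spin(r)` in `so(V) ⊕ so(W)`
      (r % 8 = 0 → ρ.spinCentralizer₂ τ = ⊥) ∧
      (r % 8 = 4 → Nonempty
        (ρ.spinCentralizer₂ τ ≃ₗ⁅ℝ⁆ SpinCentralizer.sp 1 × SpinCentralizer.sp 1)) ∧
      -- the trivial `Spin(r)`-subrepresentations of `V ⊗ W`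
      (r % 4 = 0 → ρ.tensorInvariants τ = ⊥)) := by
  refine ⟨?_, ?_⟩
  · intro V _ _ _ ρ hρ
    have hbot := hρ.spinCentralizer_eq_bot hr
    have hu := hρ.nonempty_spinCentralizer_equiv_u hr
    have hsp := hρ.nonempty_spinCentralizer_equiv_sp hr
    have hmap := ρ.map_extSqInvariants
    refine ⟨fun h => hbot (by omega), hu, fun h => hsp (by omega), fun h => ?_,
      fun h => ⟨_, hmap, hu h⟩, fun h => ⟨_, hmap, hsp h⟩, hρ.symZeroInvariants_eq_bot⟩
    rw [hbot h, LieSubalgebra.bot_toSubmodule] at hmap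
    exact Submodule.map_eq_bot_iff.1 hmap
  · intro V W _ _ _ _ _ _ ρ τ hρ hτ hne
    refine ⟨fun h => ?_, fun h => ?_, fun _ => hρ.tensorInvariants_eq_bot hτ hne⟩
    · rw [eq_bot_iff]
      intro x hx
      have hx' := SpinCentralizer.EuclideanRep.mem_spinCentralizer₂.1 hx
      rw [hρ.spinCentralizer_eq_bot hr (.inl h), hτ.spinCentralizer_eq_bot hr (.inl h)] at hx'
      exact Prod.ext hx'.1 hx'.2
    · exact SpinCentralizer.EuclideanRep.nonempty_spinCentralizer₂_equiv
        (hρ.nonempty_spinCentralizer_equiv_sp hr (by omega))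
        (hτ.nonempty_spinCentralizer_equiv_sp hr (by omega))
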